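/- For real $\alpha$ with $0<\alpha<\tfrac12$, put $\sigma_\alpha(n)=\sum_{d\mid n}d^{\alpha}$ and define $E_\alpha(x)$ by $$\sum_{1\le n\le x}\sigma_\alpha(n)=\frac{x^{1+\alpha}}{1+\alpha}\,\zeta(1+\alpha)+x\,\zeta(1-\alpha)+E_\alpha(x),$$ where $\zeta$ is the Riemann zeta function. Then for every $\varepsilon>0$, as $x\to+\infty$ through the reals, $$E_\alpha(x)=O_{\alpha,\varepsilon}\left(x^{\frac{2\alpha^2+3\alpha+1}{2\alpha+3}+\varepsilon}\right).$$ Moreover, for a real number $\alpha>0$, there is some $\varepsilon>0$ with $x^{\frac{2\alpha^2+3\alpha+1}{2\alpha+3}+\varepsilon}=o(x)$ as $x\to+\infty$ (that is, this bound is better than $O(x)$) if and only if $\alpha<\frac{\sqrt{17}-1}{4}$; in particular this is the case for all $0<\alpha<\tfrac12$. -/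

import Mathlib

/-- The fractional divisor function `σ_α(n) = ∑_{d ∣ n} d ^ α` with real exponent `α`. -/
noncomputable def fracSigma (α : ℝ) (n : ℕ) : ℝ :=
  ∑ d ∈ n.divisors, (d : ℝ) ^ α

/-- The error term `E_α(x)` defined by
`∑_{n ≤ x} σ_α(n) = x ^ (1 + α) / (1 + α) * ζ(1 + α) + x * ζ(1 - α) + E_α(x)`.
It is written in `ℂ` because `riemannZeta` is complex valued. -/
noncomputable def sigmaError (α x : ℝ) : ℂ :=
  ((∑ n ∈ Finset.Icc 1 ⌊x⌋₊, fracSigma α n : ℝ) : ℂ)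
    - ((x ^ (1 + α) / (1 + α) : ℝ) : ℂ) * riemannZeta (1 + (α : ℂ))
    - (x : ℂ) * riemannZeta (1 - (α : ℂ))

/-! The error term satisfies the stronger bound `O(x ^ ((1 + 2α)/3 + η))` for all `0 < α < 1`. The
stated exponent is `(2α + 1)(α + 1)/(2α + 3)`, which is at least `(2α + 1)/3` because `3(α + 1) ≥ 2α
+ 3`.

Dirichlet's hyperbola method at `√x`, with Euler–Maclaurin for the power sums, makes all main terms
cancel against `ζ(1 + α)` and `ζ(1 - α)`. What remains is `O(x ^ (α/2))` minus two weighted sums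
over `n ≤ √x` of `ψ(x/n)`, where `ψ` is the sawtooth and the weights are `(x/n) ^ α` and `n ^ α`
(`exists_sigmaError_eq`).

The unweighted sums of `ψ(x/n)` are `O(x ^ (1/3 + η))`, as in Voronoi's bound for the divisor
problem (`abs_sum_sawtooth_div_le`). The route is Kusmin–Landau, then van der Corput's second
derivative test for `∑ e(hx/n)` on dyadic blocks, then a passage from exponential sums to `ψ`
through the absolutely convergent Fourier series of its antiderivative. Partial summation restores
the weights; the weight `(x/n) ^ α` is the costly one and gives the exponent `(1 + 2α)/3`.

The second half is the equivalence of `(2α² + 3α + 1)/(2α + 3) < 1` with `(4α + 1)² < 17`. -/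

open Filter Topology

/-! ### The Kusmin–Landau inequality -/

/-- The additive character `e(t) = exp(2πit)`. -/
noncomputable def expTurn (t : ℝ) : ℂ := Complex.exp ((2 * Real.pi * t : ℝ) * Complex.I)

lemma norm_expTurn (t : ℝ) : ‖expTurn t‖ = 1 := Complex.norm_exp_ofReal_mul_I _

lemma expTurn_add (s t : ℝ) : expTurn (s + t) = expTurn s * expTurn t := by
  rw [expTurn, expTurn, expTurn, ← Complex.exp_add]
  congr 1
  push_cast
  ring

lemma expTurn_intCast (k : ℤ) : expTurn k = 1 := by
  rw [expTurn, Complex.exp_eq_one_iff]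
  exact ⟨k, by push_cast; ring⟩

lemma expTurn_re (t : ℝ) : (expTurn t).re = Real.cos (2 * Real.pi * t) :=
  Complex.exp_ofReal_mul_I_re _

lemma expTurn_eq (t : ℝ) :
    expTurn t = (Real.cos (2 * Real.pi * t) : ℂ) + (Real.sin (2 * Real.pi * t) : ℂ) * Complex.I := by
  rw [expTurn, Complex.exp_mul_I, Complex.ofReal_cos, Complex.ofReal_sin]

/-- `1 / (e(t) - 1)` in terms of the cotangent. -/
noncomputable def kusminCoeff (t : ℝ) : ℂ :=
  ((-1 / 2 : ℝ) : ℂ) + ((-(1 / 2) * (Real.cos (Real.pi * t) / Real.sin (Real.pi * t)) : ℝ) : ℂ) * Complex.I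

lemma kusminCoeff_mul {t : ℝ} (ht : Real.sin (Real.pi * t) ≠ 0) :
    kusminCoeff t * (expTurn t - 1) = 1 := by
  rw [expTurn_eq, kusminCoeff, show 2 * Real.pi * t = 2 * (Real.pi * t) by ring, Real.cos_two_mul,
    Real.sin_two_mul]
  have h := Real.sin_sq_add_cos_sq (Real.pi * t)
  generalize Real.sin (Real.pi * t) = s at *
  generalize Real.cos (Real.pi * t) = c at *
  apply Complex.ext
  · simp [pow_two]
    field_simp
    ring
  · simp [pow_two]
    field_simp
    linear_combination -2 * c * h

lemma sin_pi_mul_ge {t D : ℝ} (hD : 0 < D) (h1 : D ≤ t) (h2 : t ≤ 1 - D) :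
    2 * D ≤ Real.sin (Real.pi * t) := by
  have hpi := Real.pi_pos
  rcases le_total t (1 / 2) with h | h
  · have := Real.mul_le_sin (x := Real.pi * t) (by nlinarith) (by nlinarith)
    rw [show 2 / Real.pi * (Real.pi * t) = 2 * t by field_simp] at this
    linarith
  · have := Real.mul_le_sin (x := Real.pi * (1 - t)) (by nlinarith) (by nlinarith)
    rw [show 2 / Real.pi * (Real.pi * (1 - t)) = 2 * (1 - t) by field_simp,
      show Real.pi * (1 - t) = Real.pi - Real.pi * t by ring, Real.sin_pi_sub] at this
    linarith

lemma abs_cot_le {t D : ℝ} (hD : 0 < D) (h1 : D ≤ t) (h2 : t ≤ 1 - D) :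
    |Real.cos (Real.pi * t) / Real.sin (Real.pi * t)| ≤ 1 / (2 * D) := by
  have h := sin_pi_mul_ge hD h1 h2
  rw [abs_div, abs_of_pos (by linarith : 0 < Real.sin (Real.pi * t))]
  exact div_le_div₀ zero_le_one (Real.abs_cos_le_one _) (by linarith) h

lemma cot_antitone {s t D : ℝ} (hD : 0 < D) (h1 : D ≤ s) (hst : s ≤ t) (h2 : t ≤ 1 - D) :
    Real.cos (Real.pi * t) / Real.sin (Real.pi * t) ≤
      Real.cos (Real.pi * s) / Real.sin (Real.pi * s) := by
  have hs := sin_pi_mul_ge hD h1 (hst.trans h2)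
  have ht := sin_pi_mul_ge hD (h1.trans hst) h2
  rw [div_le_div_iff₀ (by linarith) (by linarith)]
  have := Real.sin_nonneg_of_nonneg_of_le_pi (x := Real.pi * t - Real.pi * s)
    (by nlinarith [Real.pi_pos]) (by nlinarith [Real.pi_pos])
  rw [Real.sin_sub] at this
  linarith

lemma norm_kusminCoeff_le {t D : ℝ} (hD : 0 < D) (h1 : D ≤ t) (h2 : t ≤ 1 - D) :
    ‖kusminCoeff t‖ ≤ 1 / (4 * D) + 1 / 2 := by
  have h := abs_cot_le hD h1 h2
  refine (norm_add_le _ _).trans ?_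
  rw [norm_mul, Complex.norm_I, mul_one, Complex.norm_real, Complex.norm_real, Real.norm_eq_abs,
    Real.norm_eq_abs, abs_mul]
  rw [show 1 / (4 * D) = 1 / 2 * (1 / (2 * D)) by field_simp; norm_num]
  norm_num at h ⊢
  linarith

/-- The real part of the coefficient is constant and the cotangent decreases, so the norm of a
difference is itself a difference of real numbers. Hence total variations telescope, and the
Kusmin–Landau bound does not depend on the number of terms. -/
lemma norm_kusminCoeff_sub {s t D : ℝ} (hD : 0 < D) (h1 : D ≤ s) (hst : s ≤ t) (h2 : t ≤ 1 - D) :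
    ‖kusminCoeff t - kusminCoeff s‖ = 1 / 2 * (Real.cos (Real.pi * s) / Real.sin (Real.pi * s)) -
      1 / 2 * (Real.cos (Real.pi * t) / Real.sin (Real.pi * t)) := by
  have h := cot_antitone hD h1 hst h2
  rw [kusminCoeff, kusminCoeff, add_sub_add_left_eq_sub, ← sub_mul, norm_mul, Complex.norm_I,
    mul_one, ← Complex.ofReal_sub, Complex.norm_real, Real.norm_eq_abs, abs_of_nonneg] <;> linarith

/-- Kusmin–Landau inequality, for increments in `[D, 1 - D]`. -/
lemma kusmin_landau_zero {a : ℕ → ℝ} {m n : ℕ} {D : ℝ} (hD : 0 < D)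
    (hmono : ∀ j, m ≤ j → j + 1 < n → a (j + 1) - a j ≤ a (j + 2) - a (j + 1))
    (hlo : ∀ j, m ≤ j → j < n → D ≤ a (j + 1) - a j)
    (hhi : ∀ j, m ≤ j → j < n → a (j + 1) - a j ≤ 1 - D) :
    ‖∑ j ∈ Finset.Ico m n, expTurn (a j)‖ ≤ 2 / D := by
  rcases le_or_gt n m with h | hmn
  · simp only [Finset.Ico_eq_empty_of_le h, Finset.sum_empty, norm_zero]; positivity
  have hD2 : D ≤ 1 / 2 := by linarith [hlo m le_rfl hmn, hhi m le_rfl hmn]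
  set c : ℕ → ℂ := fun j => kusminCoeff (a (j + 1) - a j) with hc
  set k : ℕ → ℝ := fun j => 1 / 2 * (Real.cos (Real.pi * (a (j + 1) - a j)) /
    Real.sin (Real.pi * (a (j + 1) - a j))) with hk
  have hterm : ∀ j, m ≤ j → j < n → expTurn (a j) = c j * (expTurn (a (j + 1)) - expTurn (a j)) := by
    intro j h1 h2
    have hs := sin_pi_mul_ge hD (hlo j h1 h2) (hhi j h1 h2)
    have := kusminCoeff_mul (t := a (j + 1) - a j) (by linarith)
    rw [show expTurn (a (j + 1)) = expTurn (a (j + 1) - a j) * expTurn (a j) by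
      rw [← expTurn_add]; congr 1; ring]
    simp only [hc]
    linear_combination (-expTurn (a j)) * this
  -- Summation by parts applied to `e(a_j) = c_j (e(a_{j+1}) - e(a_j))`: the sum is a boundary term
  -- up to the total variation of `c`, which telescopes to `k m - k l`.
  have key : ∀ l, m ≤ l → l < n → ‖∑ j ∈ Finset.Ico m (l + 1), expTurn (a j)
      - (c l * expTurn (a (l + 1)) - c m * expTurn (a m))‖ ≤ k m - k l := by
    intro l hl
    induction l, hl using Nat.le_induction with
    | base =>
      intro h
      rw [Nat.Ico_succ_singleton, Finset.sum_singleton]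
      nth_rw 1 [hterm m le_rfl h]
      rw [mul_sub, sub_self, norm_zero, sub_self]
    | succ l hl ih =>
      intro h
      rw [Finset.sum_Ico_succ_top (by omega)]
      have h1 := ih (by omega)
      have h2 : ‖c (l + 1) - c l‖ = k l - k (l + 1) :=
        norm_kusminCoeff_sub hD (hlo l hl (by omega)) (hmono l hl h) (hhi (l + 1) (by omega) h)
      have h3 := hterm (l + 1) (by omega) h
      calc _ = ‖(∑ j ∈ Finset.Ico m (l + 1), expTurn (a j)
            - (c l * expTurn (a (l + 1)) - c m * expTurn (a m)))
            + -(c (l + 1) - c l) * expTurn (a (l + 1))‖ := by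
            congr 1
            linear_combination h3
        _ ≤ _ := by
          refine (norm_add_le _ _).trans ?_
          rw [norm_mul, norm_neg, norm_expTurn, h2]
          linarith
  have h1 := key (n - 1) (by omega) (by omega)
  rw [Nat.sub_add_cancel (by omega : 1 ≤ n)] at h1
  have bc : ∀ j, m ≤ j → j < n → ‖c j‖ ≤ 1 / (4 * D) + 1 / 2 :=
    fun j u v => norm_kusminCoeff_le hD (hlo j u v) (hhi j u v)
  have bk : ∀ j, m ≤ j → j < n → |k j| ≤ 1 / (4 * D) := by
    intro j u v
    have := abs_cot_le hD (hlo j u v) (hhi j u v)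
    simp only [hk, abs_mul]
    rw [show 1 / (4 * D) = 1 / 2 * (1 / (2 * D)) by field_simp; norm_num]
    norm_num at this ⊢
    linarith
  have hb1 := bc m le_rfl hmn
  have hb2 := bc (n - 1) (by omega) (by omega)
  have hb3 := abs_le.1 (bk m le_rfl hmn)
  have hb4 := abs_le.1 (bk (n - 1) (by omega) (by omega))
  have hbb : ‖c (n - 1) * expTurn (a n) - c m * expTurn (a m)‖ ≤ 2 * (1 / (4 * D) + 1 / 2) := by
    refine (norm_sub_le _ _).trans ?_
    rw [norm_mul, norm_mul, norm_expTurn, norm_expTurn]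
    linarith
  have htri := norm_add_le (∑ j ∈ Finset.Ico m n, expTurn (a j)
      - (c (n - 1) * expTurn (a n) - c m * expTurn (a m)))
      (c (n - 1) * expTurn (a n) - c m * expTurn (a m))
  rw [sub_add_cancel] at htri
  have h4 : 1 / (4 * D) = 1 / 4 * (1 / D) := by field_simp
  have h5 : 2 ≤ 1 / D := by rw [le_div_iff₀ hD]; linarith
  have h6 : 2 / D = 2 * (1 / D) := by field_simp
  rw [h4] at hb3 hb4 hbb
  rw [h6]
  linarith

/-- Kusmin–Landau inequality, for increments in `[k + D, k + 1 - D]` with `k` an integer. -/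
lemma kusmin_landau {a : ℕ → ℝ} {m n : ℕ} {D : ℝ} (k : ℤ) (hD : 0 < D)
    (hmono : ∀ j, m ≤ j → j + 1 < n → a (j + 1) - a j ≤ a (j + 2) - a (j + 1))
    (hlo : ∀ j, m ≤ j → j < n → k + D ≤ a (j + 1) - a j)
    (hhi : ∀ j, m ≤ j → j < n → a (j + 1) - a j ≤ k + 1 - D) :
    ‖∑ j ∈ Finset.Ico m n, expTurn (a j)‖ ≤ 2 / D := by
  -- Subtracting the integer `k * j` from `a j` moves every increment into `[D, 1 - D]` and leaves
  -- `e(a j)` unchanged.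
  have h := kusmin_landau_zero (a := fun j => a j + ((-(k * j) : ℤ) : ℝ)) (m := m) (n := n) hD
    (fun j h1 h2 => by have := hmono j h1 h2; push_cast; linarith)
    (fun j h1 h2 => by have := hlo j h1 h2; push_cast; linarith)
    (fun j h1 h2 => by have := hhi j h1 h2; push_cast; linarith)
  simpa only [expTurn_add, expTurn_intCast, mul_one] using h

/-! ### Van der Corput's second derivative test -/

lemma exists_eq_Ico_of_ordConnected (s : Finset ℕ)
    (h : ∀ i ∈ s, ∀ j ∈ s, ∀ l, i ≤ l → l ≤ j → l ∈ s) : ∃ a b, s = Finset.Ico a b := by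
  rcases s.eq_empty_or_nonempty with rfl | hs
  · exact ⟨0, 0, by simp⟩
  · refine ⟨s.min' hs, s.max' hs + 1, ?_⟩
    ext l
    rw [Finset.mem_Ico]
    exact ⟨fun hl => ⟨s.min'_le l hl, Nat.lt_succ_of_le (s.le_max' l hl)⟩,
      fun hl => h _ (s.min'_mem hs) _ (s.max'_mem hs) l hl.1 (by omega)⟩

/-- A `lam`-separated increasing sequence has few terms in a short interval. -/
lemma card_filter_le_of_separated {g : ℕ → ℝ} {m n : ℕ} {lam p q : ℝ} (hlam : 0 < lam)
    (hpq : p ≤ q)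
    (hg : ∀ i j, m ≤ i → i ≤ j → j < n → lam * ((j : ℝ) - i) ≤ g j - g i) :
    (((Finset.Ico m n).filter fun j => p ≤ g j ∧ g j ≤ q).card : ℝ) ≤ (q - p) / lam + 1 := by
  set s := (Finset.Ico m n).filter fun j => p ≤ g j ∧ g j ≤ q with hs
  rcases s.eq_empty_or_nonempty with h | h
  · rw [h, Finset.card_empty, Nat.cast_zero]
    have : 0 ≤ (q - p) / lam := div_nonneg (by linarith) hlam.le
    linarith
  · have h1 := s.min'_mem h
    have h2 := s.max'_mem h
    have h3 : s ⊆ Finset.Icc (s.min' h) (s.max' h) := fun l hl =>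
      Finset.mem_Icc.2 ⟨s.min'_le l hl, s.le_max' l hl⟩
    have h4 := Finset.card_le_card h3
    have h5 := s.min'_le_max' h
    rw [Nat.card_Icc] at h4
    generalize s.min' h = u at *
    generalize s.max' h = v at *
    simp only [hs, Finset.mem_filter, Finset.mem_Ico] at h1 h2
    have h6 := hg u v h1.1.1 h5 h2.1.2
    have h7 : (s.card : ℝ) ≤ (v : ℝ) + 1 - u := by
      have : s.card + u ≤ v + 1 := by omega
      have : (s.card : ℝ) + u ≤ v + 1 := by exact_mod_cast this
      linarith
    have h8 : (v : ℝ) - u ≤ (q - p) / lam := by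
      rw [le_div_iff₀ hlam]
      linarith [h1.2.1, h2.2.2]
    linarith

/-- The part of an exponential sum whose increments lie in one unit interval. -/
lemma norm_sum_fiber_le {a : ℕ → ℝ} {m n : ℕ} {lam D : ℝ} (k : ℤ) (hlam : 0 < lam) (hD : 0 < D)
    (hg : ∀ i j, m ≤ i → i ≤ j → j < n →
      lam * ((j : ℝ) - i) ≤ (a (j + 1) - a j) - (a (i + 1) - a i)) :
    ‖∑ j ∈ (Finset.Ico m n).filter (fun j => ⌊a (j + 1) - a j⌋ = k), expTurn (a j)‖ ≤
      2 / D + 2 * (D / lam + 1) := by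
  set g : ℕ → ℝ := fun j => a (j + 1) - a j with hgdef
  have hmono : ∀ i j, m ≤ i → i ≤ j → j < n → g i ≤ g j := by
    intro i j h1 h2 h3
    have h := hg i j h1 h2 h3
    have : (0 : ℝ) ≤ (j : ℝ) - i := sub_nonneg.2 (Nat.cast_le.2 h2)
    have := mul_nonneg hlam.le this
    simp only [hgdef]
    linarith
  -- Kusmin–Landau handles the middle range `B` of increments. The two edges `P` and `Q`, of length
  -- `D`, hold few indices by separation and are bounded trivially.
  set F := (Finset.Ico m n).filter (fun j => ⌊g j⌋ = k) with hF
  set B := (Finset.Ico m n).filter (fun j => k + D ≤ g j ∧ g j ≤ k + 1 - D) with hB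
  set P := (Finset.Ico m n).filter (fun j => (k : ℝ) ≤ g j ∧ g j ≤ k + D) with hP
  set Q := (Finset.Ico m n).filter (fun j => k + 1 - D ≤ g j ∧ g j ≤ k + 1) with hQ
  have hBF : B ⊆ F := by
    intro j hj
    simp only [hB, hF, Finset.mem_filter] at hj ⊢
    exact ⟨hj.1, Int.floor_eq_iff.2 ⟨by linarith, by linarith⟩⟩
  have hsd : F \ B ⊆ P ∪ Q := by
    intro j hj
    simp only [hB, hF, hP, hQ, Finset.mem_sdiff, Finset.mem_union, Finset.mem_filter,
      Int.floor_eq_iff] at hj ⊢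
    obtain ⟨⟨h1, h2, h3⟩, h4⟩ := hj
    rcases le_or_gt (k + D) (g j) with h | h
    · right
      refine ⟨h1, ?_, h3.le⟩
      by_contra! h5
      exact h4 ⟨h1, h, h5.le⟩
    · exact Or.inl ⟨h1, h2, h.le⟩
  have hcard : ((F \ B).card : ℝ) ≤ 2 * (D / lam + 1) := by
    have h1 : (P.card : ℝ) ≤ _ := card_filter_le_of_separated (p := k) (q := k + D) hlam (by linarith) hg
    have h2 : (Q.card : ℝ) ≤ _ :=
      card_filter_le_of_separated (p := k + 1 - D) (q := k + 1) hlam (by linarith) hg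
    have h3 : ((F \ B).card : ℝ) ≤ P.card + Q.card := by
      exact_mod_cast (Finset.card_le_card hsd).trans (Finset.card_union_le _ _)
    rw [show (k + D - k : ℝ) = D by ring] at h1
    rw [show (k + 1 - (k + 1 - D) : ℝ) = D by ring] at h2
    linarith
  have hmid : ‖∑ j ∈ B, expTurn (a j)‖ ≤ 2 / D := by
    obtain ⟨u, v, huv⟩ := exists_eq_Ico_of_ordConnected B (by
      intro i hi j hj l h1 h2
      simp only [hB, Finset.mem_filter, Finset.mem_Ico] at hi hj ⊢
      exact ⟨⟨by omega, by omega⟩, hi.2.1.trans (hmono i l hi.1.1 h1 (by omega)),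
        (hmono l j (by omega) h2 hj.1.2).trans hj.2.2⟩)
    have hmem : ∀ j, u ≤ j → j < v → (m ≤ j ∧ j < n) ∧ k + D ≤ g j ∧ g j ≤ k + 1 - D := by
      intro j h1 h2
      have : j ∈ B := huv ▸ Finset.mem_Ico.2 ⟨h1, h2⟩
      simpa only [hB, Finset.mem_filter, Finset.mem_Ico] using this
    rw [huv]
    refine kusmin_landau k hD (fun j h1 h2 => ?_) (fun j h1 h2 => (hmem j h1 h2).2.1)
      (fun j h1 h2 => (hmem j h1 h2).2.2)
    exact hmono j (j + 1) (hmem j h1 (by omega)).1.1 (by omega) (hmem (j + 1) (by omega) h2).1.2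
  rw [← Finset.sum_sdiff hBF]
  refine (norm_add_le _ _).trans ?_
  have : ‖∑ j ∈ F \ B, expTurn (a j)‖ ≤ (F \ B).card := by
    refine (norm_sum_le _ _).trans ?_
    simp [norm_expTurn]
  linarith

/-- Van der Corput's second derivative test, in discrete form. -/
lemma van_der_corput {a : ℕ → ℝ} {m n : ℕ} {lam L : ℝ} (hlam : 0 < lam) (hlam1 : lam ≤ 1)
    (hL : 0 ≤ L)
    (hg : ∀ i j, m ≤ i → i ≤ j → j < n →
      lam * ((j : ℝ) - i) ≤ (a (j + 1) - a j) - (a (i + 1) - a i))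
    (hrange : ∀ j, m ≤ j → j < n → (a (j + 1) - a j) - (a (m + 1) - a m) ≤ L) :
    ‖∑ j ∈ Finset.Ico m n, expTurn (a j)‖ ≤ 6 * (L + 2) / √lam := by
  -- This choice balances the Kusmin–Landau term `2 / D` against the edge count `D / lam`.
  set D := √lam with hDdef
  have hD : 0 < D := Real.sqrt_pos.2 hlam
  have hDD : D * D = lam := Real.mul_self_sqrt hlam.le
  have hD1 : D ≤ 1 := Real.sqrt_le_one.2 hlam1
  set g : ℕ → ℝ := fun j => a (j + 1) - a j with hgdef
  have hmaps : ∀ j ∈ Finset.Ico m n, ⌊g j⌋ ∈ Finset.Icc ⌊g m⌋ ⌊g m + L⌋ := by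
    intro j hj
    rw [Finset.mem_Ico] at hj
    have h := hg m j le_rfl hj.1 hj.2
    have h0 : (0 : ℝ) ≤ (j : ℝ) - m := sub_nonneg.2 (Nat.cast_le.2 hj.1)
    have h1 := mul_nonneg hlam.le h0
    have h2 := hrange j hj.1 hj.2
    exact Finset.mem_Icc.2 ⟨Int.floor_le_floor (by simp only [hgdef]; linarith),
      Int.floor_le_floor (by simp only [hgdef]; linarith)⟩
  rw [← Finset.sum_fiberwise_of_maps_to hmaps]
  have hcard : ((Finset.Icc ⌊g m⌋ ⌊g m + L⌋).card : ℝ) ≤ L + 2 := by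
    rw [Int.card_Icc]
    have h1 : ⌊g m⌋ ≤ ⌊g m + L⌋ := Int.floor_le_floor (by linarith)
    have h2 : (((⌊g m + L⌋ + 1 - ⌊g m⌋).toNat : ℤ) : ℝ) = ⌊g m + L⌋ + 1 - ⌊g m⌋ := by
      rw [Int.toNat_of_nonneg (by omega)]; push_cast; ring
    rw [Int.cast_natCast] at h2
    rw [h2]
    linarith [Int.floor_le (g m + L), Int.lt_floor_add_one (g m)]
  calc _ ≤ ∑ k ∈ Finset.Icc ⌊g m⌋ ⌊g m + L⌋, (2 / D + 2 * (D / lam + 1)) :=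
        (norm_sum_le _ _).trans (Finset.sum_le_sum fun k _ => norm_sum_fiber_le k hlam hD hg)
    _ = (Finset.Icc ⌊g m⌋ ⌊g m + L⌋).card * (2 / D + 2 * (D / lam + 1)) := by
        rw [Finset.sum_const, nsmul_eq_mul]
    _ ≤ (L + 2) * (6 / D) := by
        have h1 : D / lam = 1 / D := by rw [← hDD]; field_simp
        have h2 : 1 ≤ 1 / D := by rw [le_div_iff₀ hD]; linarith
        have h3 : 2 / D + 2 * (D / lam + 1) ≤ 6 / D := by
          rw [h1, show 2 / D = 2 * (1 / D) by ring, show 6 / D = 6 * (1 / D) by ring]; linarith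
        have h4 : 0 ≤ 6 / D := by positivity
        refine mul_le_mul hcard h3 ?_ (by linarith)
        rw [h1]; positivity
    _ = _ := by ring

/-! ### Sawtooth sums from exponential sums -/

/-- The sawtooth function `t - ⌊t⌋ - 1/2`. -/
noncomputable def sawtooth (t : ℝ) : ℝ := Int.fract t - 1 / 2

/-- A periodic antiderivative of the sawtooth function. -/
noncomputable def sawtoothInt (t : ℝ) : ℝ := (Int.fract t ^ 2 - Int.fract t + 1 / 6) / 2

lemma abs_sawtooth_le (t : ℝ) : |sawtooth t| ≤ 1 / 2 := by
  rw [sawtooth, abs_le]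
  constructor <;> linarith [Int.fract_nonneg t, Int.fract_lt_one t]

lemma fract_add_eq (t d : ℝ) : Int.fract (t + d) = Int.fract (Int.fract t + d) := by
  conv_lhs => rw [← Int.fract_add_floor t, add_right_comm, Int.fract_add_intCast]

/-- The sawtooth has slope 1 and only downward jumps, so it lies below its tangent line to the right
of `t`; integrating over `[t, t + d]` gives the bound. `le_sawtoothInt_sub` is the mirror image to
the left of `t`. -/
lemma sawtoothInt_add_le {t d : ℝ} (hd : 0 ≤ d) :
    sawtoothInt (t + d) - sawtoothInt t ≤ d * sawtooth t + d ^ 2 / 2 := by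
  have h1 : Int.fract (t + d) = Int.fract t + d - ⌊Int.fract t + d⌋ := by
    rw [Int.self_sub_floor, fract_add_eq]
  have h2 : (0 : ℤ) ≤ ⌊Int.fract t + d⌋ := Int.floor_nonneg.2 (by linarith [Int.fract_nonneg t])
  have h3 := Int.floor_le (Int.fract t + d)
  rw [sawtoothInt, sawtoothInt, sawtooth, h1]
  generalize ⌊Int.fract t + d⌋ = k at *
  generalize Int.fract t = u at *
  rcases h2.eq_or_lt with rfl | hk
  · push_cast; nlinarith
  · have : (1 : ℝ) ≤ k := by exact_mod_cast hk
    nlinarith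

lemma le_sawtoothInt_sub {t d : ℝ} (hd : 0 ≤ d) :
    d * sawtooth t - d ^ 2 / 2 ≤ sawtoothInt t - sawtoothInt (t - d) := by
  have h1 : Int.fract (t - d) = Int.fract t - d - ⌊Int.fract t - d⌋ := by
    rw [Int.self_sub_floor, sub_eq_add_neg, sub_eq_add_neg, fract_add_eq]
  have h2 : ⌊Int.fract t - d⌋ ≤ (0 : ℤ) :=
    Int.lt_add_one_iff.1 (Int.floor_lt.2 (by push_cast; linarith [Int.fract_lt_one t]))
  have h3 := Int.lt_floor_add_one (Int.fract t - d)
  rw [sawtoothInt, sawtoothInt, sawtooth, h1]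
  generalize ⌊Int.fract t - d⌋ = k at *
  generalize Int.fract t = u at *
  rcases h2.eq_or_lt with rfl | hk
  · push_cast; nlinarith
  · have : (k : ℝ) ≤ -1 := by exact_mod_cast Int.le_sub_one_of_lt hk
    nlinarith

lemma eval_bernoulli_two (x : ℝ) :
    (Polynomial.map (algebraMap ℚ ℝ) (Polynomial.bernoulli 2)).eval x = x ^ 2 - x + 1 / 6 := by
  simp [Polynomial.bernoulli, Finset.sum_range_succ, bernoulli, bernoulli'_two, Nat.choose]
  ring

/-- This is the Fourier series of the second Bernoulli polynomial. It converges absolutely, unlike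
that of the sawtooth, which is why the argument goes through the antiderivative. -/
lemma hasSum_sawtoothInt (t : ℝ) :
    HasSum (fun h : ℕ => 1 / (h : ℝ) ^ 2 * Real.cos (2 * Real.pi * (h * t)))
      (2 * Real.pi ^ 2 * sawtoothInt t) := by
  have h := hasSum_one_div_nat_pow_mul_cos one_ne_zero (x := Int.fract t)
    ⟨Int.fract_nonneg t, (Int.fract_lt_one t).le⟩
  rw [mul_one, eval_bernoulli_two] at h
  convert h using 1
  · ext n
    rw [Int.fract]
    congr 1
    rw [← Real.cos_sub_int_mul_two_pi _ (n * ⌊t⌋)]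
    congr 1
    push_cast
    ring
  · rw [sawtoothInt]
    norm_num [Nat.factorial]
    ring

/-- Interpolates between the bounds `2π|t|` and `2`. -/
lemma norm_expTurn_sub_one_le {t s : ℝ} (hs0 : 0 ≤ s) (hs1 : s ≤ 1) :
    ‖expTurn t - 1‖ ≤ 2 * (Real.pi * |t|) ^ s := by
  have hp := Real.pi_pos
  have h0 : 0 ≤ Real.pi * |t| := by positivity
  rcases le_total (Real.pi * |t|) 1 with h | h
  · have h1 : ‖expTurn t - 1‖ ≤ 2 * (Real.pi * |t|) := by
      have := Real.norm_exp_I_mul_ofReal_sub_one_le (x := 2 * Real.pi * t)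
      rw [mul_comm Complex.I] at this
      refine this.trans (le_of_eq ?_)
      rw [Real.norm_eq_abs, abs_mul, abs_of_pos (by positivity : 0 < 2 * Real.pi)]
      ring
    have h2 : Real.pi * |t| ≤ (Real.pi * |t|) ^ s := by
      rcases h0.eq_or_lt with h0 | h0
      · rw [← h0]; positivity
      · simpa using Real.rpow_le_rpow_of_exponent_ge h0 h hs1
    linarith
  · have h1 : ‖expTurn t - 1‖ ≤ 2 := by
      refine (norm_sub_le _ _).trans ?_
      rw [norm_expTurn, norm_one]
      norm_num
    have := Real.one_le_rpow h hs0
    linarith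

/-- A shift by `d` inserts the factor `e(hd) - 1` in the `h`-th Fourier term. Interpolated with
exponent `1/2 - η`, the term has size `h^(-2) · h^(1/2 - η) · h^(1/2) = h^(-1 - η)`, just enough for
convergence. -/
lemma sum_sawtoothInt_shift_le {s : Finset ℕ} {t : ℕ → ℝ} {A η : ℝ} (hη : 0 < η)
    (hη1 : η ≤ 1 / 2)
    (hA : ∀ h : ℕ, 1 ≤ h → ‖∑ n ∈ s, expTurn (h * t n)‖ ≤ A * √h) (d : ℝ) :
    |∑ n ∈ s, (sawtoothInt (t n + d) - sawtoothInt (t n))| ≤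
      A * |d| ^ (1 / 2 - η) * ∑' h : ℕ, 1 / (h : ℝ) ^ (1 + η) := by
  have hA0 : 0 ≤ A := by simpa using (norm_nonneg _).trans (hA 1 le_rfl)
  have hsum : HasSum (fun h : ℕ => ∑ n ∈ s, (1 / (h : ℝ) ^ 2 *
      Real.cos (2 * Real.pi * (h * (t n + d))) - 1 / (h : ℝ) ^ 2 * Real.cos (2 * Real.pi * (h * t n))))
      (∑ n ∈ s, (2 * Real.pi ^ 2 * sawtoothInt (t n + d) - 2 * Real.pi ^ 2 * sawtoothInt (t n))) :=
    hasSum_sum fun n _ => (hasSum_sawtoothInt _).sub (hasSum_sawtoothInt _)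
  have hterm : ∀ h : ℕ, ‖∑ n ∈ s, (1 / (h : ℝ) ^ 2 *
      Real.cos (2 * Real.pi * (h * (t n + d))) - 1 / (h : ℝ) ^ 2 * Real.cos (2 * Real.pi * (h * t n)))‖
      ≤ 2 * Real.pi ^ 2 * (A * |d| ^ (1 / 2 - η)) * (1 / (h : ℝ) ^ (1 + η)) := by
    intro h
    rcases Nat.eq_zero_or_pos h with rfl | hh
    · simp only [Nat.cast_zero, ne_eq, OfNat.ofNat_ne_zero, not_false_eq_true, zero_pow, div_zero,
        zero_mul, sub_self, Finset.sum_const_zero, norm_zero]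
      positivity
    have hh' : (0 : ℝ) < h := Nat.cast_pos.2 hh
    have heq : ∑ n ∈ s, (1 / (h : ℝ) ^ 2 * Real.cos (2 * Real.pi * (h * (t n + d))) -
        1 / (h : ℝ) ^ 2 * Real.cos (2 * Real.pi * (h * t n))) =
        1 / (h : ℝ) ^ 2 * ((expTurn (h * d) - 1) * ∑ n ∈ s, expTurn (h * t n)).re := by
      rw [Finset.mul_sum, Complex.re_sum, Finset.mul_sum]
      refine Finset.sum_congr rfl fun n _ => ?_
      rw [sub_mul, ← expTurn_add, one_mul, Complex.sub_re, expTurn_re, expTurn_re, mul_sub,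
        show (h : ℝ) * (t n + d) = h * d + h * t n by ring]
    rw [heq, norm_mul, Real.norm_of_nonneg (by positivity)]
    have h1 : ‖((expTurn (h * d) - 1) * ∑ n ∈ s, expTurn (h * t n)).re‖ ≤
        2 * (Real.pi * |h * d|) ^ (1 / 2 - η) * (A * √h) := by
      refine (Complex.abs_re_le_norm _).trans ?_
      rw [norm_mul]
      exact mul_le_mul (norm_expTurn_sub_one_le (by linarith) (by linarith)) (hA h hh)
        (norm_nonneg _) (by positivity)
    refine (mul_le_mul_of_nonneg_left h1 (by positivity)).trans ?_
    rw [abs_mul, abs_of_pos hh', Real.mul_rpow Real.pi_pos.le (by positivity),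
      Real.mul_rpow hh'.le (abs_nonneg d), Real.sqrt_eq_rpow]
    -- Wasteful, but the resulting `2π²` cancels the normalisation of the Fourier series at the end.
    have h2 : Real.pi ^ (1 / 2 - η) ≤ Real.pi ^ (2 : ℝ) :=
      Real.rpow_le_rpow_of_exponent_le (by linarith [Real.pi_gt_three]) (by linarith)
    rw [Real.rpow_two] at h2
    have h3 : 1 / (h : ℝ) ^ 2 * ((h : ℝ) ^ (1 / 2 - η) * (h : ℝ) ^ (1 / 2 : ℝ)) =
        1 / (h : ℝ) ^ (1 + η) := by
      rw [one_div, one_div ((h : ℝ) ^ (1 + η)), ← Real.rpow_natCast, ← Real.rpow_neg hh'.le, ← Real.rpow_neg hh'.le,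
        ← Real.rpow_add hh', ← Real.rpow_add hh']
      congr 1
      push_cast
      ring
    calc _ = 2 * Real.pi ^ (1 / 2 - η) * (A * |d| ^ (1 / 2 - η)) *
          (1 / (h : ℝ) ^ 2 * ((h : ℝ) ^ (1 / 2 - η) * (h : ℝ) ^ (1 / 2 : ℝ))) := by ring
      _ ≤ _ := by
        rw [h3]
        gcongr
  have hZ : Summable fun h : ℕ => 1 / (h : ℝ) ^ (1 + η) :=
    Real.summable_one_div_nat_rpow.2 (by linarith)
  have h4 := tsum_of_norm_bounded (hZ.hasSum.mul_left _) hterm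
  rw [hsum.tsum_eq] at h4
  simp_rw [← mul_sub] at h4
  rw [← Finset.mul_sum, norm_mul, Real.norm_of_nonneg (by positivity), mul_assoc (2 * Real.pi ^ 2)] at h4
  exact le_of_mul_le_mul_left h4 (by positivity)

/-- Bound for a sum of sawtooth values in terms of exponential sums. -/
lemma abs_sum_sawtooth_le {s : Finset ℕ} {t : ℕ → ℝ} {A η d : ℝ} (hη : 0 < η)
    (hη1 : η ≤ 1 / 2) (hd : 0 < d)
    (hA : ∀ h : ℕ, 1 ≤ h → ‖∑ n ∈ s, expTurn (h * t n)‖ ≤ A * √h) :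
    |∑ n ∈ s, sawtooth (t n)| ≤
      s.card * d + A * d ^ (-1 / 2 - η) * ∑' h : ℕ, 1 / (h : ℝ) ^ (1 + η) := by
  set Z := ∑' h : ℕ, 1 / (h : ℝ) ^ (1 + η)
  have h1 := abs_le.1 (sum_sawtoothInt_shift_le hη hη1 hA d)
  have h2 := abs_le.1 (sum_sawtoothInt_shift_le hη hη1 hA (-d))
  rw [abs_neg] at h2
  rw [abs_of_pos hd] at h1 h2
  -- The shift by `d` bounds the sawtooth sum from below, the shift by `-d` from above.
  have h3 : ∑ n ∈ s, (sawtoothInt (t n + d) - sawtoothInt (t n)) ≤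
      d * ∑ n ∈ s, sawtooth (t n) + s.card * (d ^ 2 / 2) := by
    rw [Finset.mul_sum, ← nsmul_eq_mul, ← Finset.sum_const, ← Finset.sum_add_distrib]
    exact Finset.sum_le_sum fun n _ => sawtoothInt_add_le hd.le
  have h4 : d * ∑ n ∈ s, sawtooth (t n) - s.card * (d ^ 2 / 2) ≤
      -∑ n ∈ s, (sawtoothInt (t n + -d) - sawtoothInt (t n)) := by
    rw [Finset.mul_sum, ← nsmul_eq_mul, ← Finset.sum_const, ← Finset.sum_sub_distrib,
      ← Finset.sum_neg_distrib]
    refine Finset.sum_le_sum fun n _ => ?_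
    rw [neg_sub, ← sub_eq_add_neg]
    exact le_sawtoothInt_sub hd.le
  have h5 : d ^ (1 / 2 - η) = d * d ^ (-1 / 2 - η) := by
    nth_rw 2 [← Real.rpow_one d]
    rw [← Real.rpow_add hd]
    congr 1
    ring
  have h6 : |d * ∑ n ∈ s, sawtooth (t n)| ≤ d * (s.card * d + A * d ^ (-1 / 2 - η) * Z) := by
    rw [h5] at h1 h2
    have : 0 ≤ (s.card : ℝ) * (d ^ 2 / 2) := by positivity
    rw [abs_le]
    constructor <;> linarith
  rw [abs_mul, abs_of_pos hd] at h6
  exact le_of_mul_le_mul_left h6 hd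

/-! ### Sums of the sawtooth at `x / n` -/

/-- For `n` in `[E, 2E)` the increments of `X/n` are separated by at least `X/(8E³)` and vary by at
most `X/E²`, which is at least 1; the second derivative test then gives `(X/E²)/√(X/E³) = √(X/E)` up
to a constant. If `X > 8E³`, the trivial bound `E` is already smaller than `√(X/E)`. -/
lemma norm_sum_expTurn_div_le {X : ℝ} {E F : ℕ} (hE : 1 ≤ E) (hX : (E : ℝ) ^ 2 ≤ X)
    (hF : F ≤ 2 * E) :
    ‖∑ n ∈ Finset.Ico E F, expTurn (X / n)‖ ≤ 54 * √(X / E) := by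
  have hE0 : (0 : ℝ) < E := by exact_mod_cast hE
  have hX0 : 0 < X := lt_of_lt_of_le (by positivity) hX
  set lam := X / (8 * (E : ℝ) ^ 3) with hlamdef
  have hlam : 0 < lam := by positivity
  rcases le_or_gt lam 1 with h1 | h1
  · have hdiff : ∀ j : ℕ, E ≤ j → X / ((j + 1 : ℕ) : ℝ) - X / (j : ℝ) = -(X / (j * (j + 1))) := by
      intro j hj
      have : (0 : ℝ) < j := by exact_mod_cast lt_of_lt_of_le hE hj
      push_cast
      field_simp
      ring
    have h := van_der_corput (a := fun n : ℕ => X / n) (m := E) (n := F) (L := X / (E : ℝ) ^ 2)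
      hlam h1 (by positivity) (by
        intro i j hi hij hj
        rw [hdiff i hi, hdiff j (hi.trans hij)]
        have hi0 : (E : ℝ) ≤ i := by exact_mod_cast hi
        have hij0 : (i : ℝ) ≤ j := by exact_mod_cast hij
        have hj0 : (j : ℝ) + 1 ≤ 2 * E := by exact_mod_cast (by omega : j + 1 ≤ 2 * E)
        have hi1 : (0 : ℝ) < i := hE0.trans_le hi0
        have hj1 : (0 : ℝ) < j := hi1.trans_le hij0
        have e1 : -(X / ((j : ℝ) * (j + 1))) - -(X / ((i : ℝ) * (i + 1))) =
            X * (j - i) * ((i + j + 1) / (i + 1)) / (i * j * (j + 1)) := by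
          field_simp
          ring
        rw [e1, hlamdef, div_mul_eq_mul_div]
        have e2 : 1 ≤ ((i : ℝ) + j + 1) / (i + 1) := by
          rw [le_div_iff₀ (by linarith)]; linarith
        have e3 : (i : ℝ) * j * (j + 1) ≤ 8 * (E : ℝ) ^ 3 := by
          calc (i : ℝ) * j * (j + 1) ≤ (2 * E) * (2 * E) * (2 * E) := by gcongr <;> linarith
            _ = _ := by ring
        have e4 : 0 ≤ X * ((j : ℝ) - i) := mul_nonneg hX0.le (by linarith)
        exact div_le_div₀ (mul_nonneg e4 (by linarith)) (le_mul_of_one_le_right e4 e2)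
          (by positivity) e3) (by
        intro j hj _
        rw [hdiff E le_rfl, hdiff j hj]
        have hj1 : (0 : ℝ) < j := hE0.trans_le (by exact_mod_cast hj)
        have : 0 ≤ X / ((j : ℝ) * (j + 1)) := by positivity
        have : X / ((E : ℝ) * (E + 1)) ≤ X / (E : ℝ) ^ 2 := by gcongr; nlinarith
        linarith)
    refine h.trans ?_
    have h2 : X / (E : ℝ) ^ 2 + 2 ≤ 3 * (X / (E : ℝ) ^ 2) := by
      have : 1 ≤ X / (E : ℝ) ^ 2 := by rw [le_div_iff₀ (by positivity)]; linarith
      linarith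
    have h3 : (X / (E : ℝ) ^ 2) = √(X / E) * (√lam * √8) := by
      rw [← Real.sqrt_mul hlam.le, ← Real.sqrt_mul (by positivity), eq_comm,
        Real.sqrt_eq_iff_mul_self_eq (by positivity) (by positivity)]
      rw [hlamdef]
      field_simp
    have h4 : √8 ≤ 3 := Real.sqrt_le_iff.2 ⟨by norm_num, by norm_num⟩
    have h5 : 0 < √lam := Real.sqrt_pos.2 hlam
    rw [div_le_iff₀ h5]
    have h6 : √(X / E) * (√lam * √8) ≤ √(X / E) * (√lam * 3) := by gcongr
    rw [h3] at h2 ⊢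
    linarith
  · have h2 : ‖∑ n ∈ Finset.Ico E F, expTurn (X / n)‖ ≤ E := by
      refine (norm_sum_le _ _).trans ?_
      simp only [norm_expTurn, Finset.sum_const, Nat.card_Ico, nsmul_eq_mul, mul_one]
      exact_mod_cast (by omega : F - E ≤ E)
    have h3 : (E : ℝ) ≤ √(X / E) := by
      apply Real.le_sqrt_of_sq_le
      rw [hlamdef, lt_div_iff₀ (by positivity)] at h1
      rw [le_div_iff₀ hE0]
      nlinarith [pow_pos hE0 3]
    have := Real.sqrt_nonneg (X / E)
    linarith

lemma abs_sum_sawtooth_div_dyadic_le {η : ℝ} (hη : 0 < η) (hη1 : η ≤ 1 / 2) :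
    ∃ C : ℝ, 0 ≤ C ∧ ∀ (x : ℝ) (E F : ℕ), 1 ≤ E → (E : ℝ) ^ 2 ≤ x → F ≤ 2 * E →
      |∑ n ∈ Finset.Ico E F, sawtooth (x / n)| ≤ C * x ^ (1 / 3 + η) := by
  have hZ0 : 0 ≤ ∑' h : ℕ, 1 / (h : ℝ) ^ (1 + η) := tsum_nonneg fun h => by positivity
  refine ⟨1 + 54 * ∑' h : ℕ, 1 / (h : ℝ) ^ (1 + η), by linarith, ?_⟩
  intro x E F hE hx hF
  set Z := ∑' h : ℕ, 1 / (h : ℝ) ^ (1 + η)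
  have hE1 : (1 : ℝ) ≤ E := by exact_mod_cast hE
  have hE0 : (0 : ℝ) < E := by linarith
  have hx1 : 1 ≤ x := by nlinarith
  have hx0 : 0 < x := by linarith
  have hA : ∀ h : ℕ, 1 ≤ h →
      ‖∑ n ∈ Finset.Ico E F, expTurn (h * (x / n))‖ ≤ 54 * √(x / E) * √h := by
    intro h hh
    have hh1 : (1 : ℝ) ≤ h := by exact_mod_cast hh
    have := norm_sum_expTurn_div_le (X := h * x) hE (by nlinarith) hF
    simp_rw [mul_div_assoc] at this
    rwa [Real.sqrt_mul (by positivity), mul_comm (√(h : ℝ)), ← mul_assoc] at this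
  -- This shift balances `E * d` against `√(x/E) * d ^ (-1/2)`: both equal `x ^ (1/3)`, whatever the
  -- block.
  set d := x ^ (1 / 3 : ℝ) / E with hd
  have hd0 : 0 < d := by positivity
  refine (abs_sum_sawtooth_le hη hη1 hd0 hA).trans ?_
  have h1 : ((Finset.Ico E F).card : ℝ) * d ≤ x ^ (1 / 3 : ℝ) := by
    have : ((Finset.Ico E F).card : ℝ) ≤ E := by
      rw [Nat.card_Ico]
      exact_mod_cast (by omega : F - E ≤ E)
    calc _ ≤ E * d := by gcongr
      _ = _ := by rw [hd]; field_simp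
  have h2 : √(x / E) * d ^ (-1 / 2 : ℝ) = x ^ (1 / 3 : ℝ) := by
    rw [hd, Real.sqrt_eq_rpow, Real.div_rpow hx0.le hE0.le, Real.div_rpow (by positivity) hE0.le,
      ← Real.rpow_mul hx0.le, div_mul_div_comm, ← Real.rpow_add hx0, ← Real.rpow_add hE0]
    norm_num
  have h3 : d ^ (-η) ≤ x ^ η := by
    have hEx : (E : ℝ) ≤ x := by nlinarith
    have : x⁻¹ ≤ d := by
      rw [hd, inv_eq_one_div]
      have := Real.one_le_rpow hx1 (by norm_num : (0 : ℝ) ≤ 1 / 3)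
      gcongr
    calc d ^ (-η) ≤ x⁻¹ ^ (-η) :=
          Real.rpow_le_rpow_of_nonpos (by positivity) this (by linarith)
      _ = x ^ η := by rw [Real.inv_rpow hx0.le, Real.rpow_neg hx0.le, inv_inv]
  have h4 : (1 : ℝ) ≤ x ^ η := Real.one_le_rpow hx1 hη.le
  have h5 : 0 < x ^ (1 / 3 : ℝ) := by positivity
  rw [Real.rpow_add hx0, sub_eq_add_neg, Real.rpow_add hd0]
  calc (Finset.Ico E F).card * d + 54 * √(x / E) * (d ^ (-1 / 2 : ℝ) * d ^ (-η)) * Z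
      = (Finset.Ico E F).card * d + 54 * (√(x / E) * d ^ (-1 / 2 : ℝ)) * d ^ (-η) * Z := by ring
    _ ≤ x ^ (1 / 3 : ℝ) * x ^ η + 54 * x ^ (1 / 3 : ℝ) * x ^ η * Z := by
        rw [h2]
        refine add_le_add (h1.trans (le_mul_of_one_le_right h5.le h4)) ?_
        gcongr
    _ = _ := by ring

/-- The sawtooth sum underlying the divisor problem is `O(x ^ (1 / 3 + η))`. -/
lemma abs_sum_sawtooth_div_le {η : ℝ} (hη : 0 < η) (hη1 : η ≤ 1) :
    ∃ C : ℝ, 0 ≤ C ∧ ∀ (x : ℝ) (F : ℕ), 1 ≤ x → (∀ n : ℕ, n < F → (n : ℝ) ^ 2 ≤ x) →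
      |∑ n ∈ Finset.Ico 1 F, sawtooth (x / n)| ≤ C * x ^ (1 / 3 + η) := by
  -- Half of `η` is kept back to absorb the logarithmic number of dyadic blocks.
  obtain ⟨C, hC, hB⟩ := abs_sum_sawtooth_div_dyadic_le (η := η / 2) (by linarith) (by linarith)
  refine ⟨C * (8 / η + 1), by positivity, ?_⟩
  intro x F hx hF
  have hx0 : 0 < x := by linarith
  have key : ∀ (k F : ℕ), F ≤ 2 ^ k → (∀ n : ℕ, n < F → (n : ℝ) ^ 2 ≤ x) →
      |∑ n ∈ Finset.Ico 1 F, sawtooth (x / n)| ≤ k * (C * x ^ (1 / 3 + η / 2)) := by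
    intro k
    induction k with
    | zero =>
      intro F hk _
      rw [Finset.Ico_eq_empty_of_le (by simpa using hk)]
      simp
    | succ k ih =>
      intro F hk hF
      have h0 : 0 ≤ C * x ^ (1 / 3 + η / 2) := by positivity
      rcases le_or_gt F (2 ^ k) with h | h
      · have := ih F h hF
        push_cast
        linarith
      · have h1 := ih (2 ^ k) le_rfl fun n hn => hF n (hn.trans h)
        have h2 := hB x (2 ^ k) F Nat.one_le_two_pow (hF _ h) (by rw [pow_succ] at hk; omega)
        rw [← Finset.sum_Ico_consecutive _ (Nat.one_le_two_pow (n := k)) h.le]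
        refine (abs_add_le _ _).trans ?_
        push_cast
        linarith
  refine (key (Nat.log 2 F + 1) F (Nat.lt_pow_succ_log_self (by norm_num) F).le hF).trans ?_
  have hlog : (Nat.log 2 F : ℝ) ≤ 8 / η * x ^ (η / 2) := by
    rcases Nat.eq_zero_or_pos F with rfl | hF0
    · simp only [Nat.log_zero_right, Nat.cast_zero]; positivity
    have hFx : (F : ℝ) ≤ 2 * x := by
      have h1 := hF (F - 1) (by omega)
      rw [Nat.cast_sub hF0, Nat.cast_one] at h1
      nlinarith
    have h1 : (2 : ℝ) ^ Nat.log 2 F ≤ F := by exact_mod_cast Nat.pow_log_le_self 2 hF0.ne'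
    have h2 := Real.log_le_log (by positivity) (h1.trans hFx)
    rw [Real.log_pow] at h2
    have h3 := Real.log_le_rpow_div (x := 2 * x) (by positivity) (show 0 < η / 2 by linarith)
    have h4 : (2 * x) ^ (η / 2) ≤ 2 * x ^ (η / 2) := by
      rw [Real.mul_rpow (by norm_num) hx0.le]
      gcongr
      exact Real.rpow_le_self_of_one_le (by norm_num) (by linarith)
    have h5 : (1 / 2 : ℝ) ≤ Real.log 2 := by linarith [Real.log_two_gt_d9]
    have h6 : (Nat.log 2 F : ℝ) * (1 / 2) ≤ Nat.log 2 F * Real.log 2 := by gcongr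
    have h7 : (2 * x) ^ (η / 2) / (η / 2) ≤ 4 / η * x ^ (η / 2) := by
      rw [div_le_iff₀ (by linarith)]
      calc _ ≤ _ := h4
        _ = _ := by field_simp; ring
    rw [show 8 / η * x ^ (η / 2) = 2 * (4 / η * x ^ (η / 2)) by ring]
    linarith
  have h1 : 1 ≤ x ^ (η / 2) := Real.one_le_rpow hx (by linarith)
  have h2 : x ^ (1 / 3 + η) = x ^ (1 / 3 + η / 2) * x ^ (η / 2) := by
    rw [← Real.rpow_add hx0]
    congr 1
    ring
  rw [h2]
  push_cast
  calc _ ≤ ((8 / η + 1) * x ^ (η / 2)) * (C * x ^ (1 / 3 + η / 2)) := by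
        gcongr
        linarith
    _ = _ := by ring

/-! ### Euler–Maclaurin summation for power sums -/

/-- The sum of `n ^ b` over the positive integers `n ≤ y`. -/
noncomputable def powSum (b y : ℝ) : ℝ := ∑ n ∈ Finset.Icc 1 ⌊y⌋₊, (n : ℝ) ^ b

/-- The Euler–Maclaurin correction on the interval `[N, N + 1]`. -/
noncomputable def eulerMaclaurinAux (b N t : ℝ) : ℝ :=
  -(t ^ (1 + b) / (1 + b)) + (t - N - 1 / 2) * t ^ b
    - b * ((t - N) ^ 2 - (t - N)) / 2 * t ^ (b - 1)

/-- The polynomial coefficients are chosen so that the terms in `t ^ b` and `t ^ (b - 1)` cancel on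
differentiation. -/
lemma hasDerivAt_eulerMaclaurinAux {b t : ℝ} (hb : b ≠ -1) (N : ℝ) (ht : 0 < t) :
    HasDerivAt (eulerMaclaurinAux b N)
      (-(b * (b - 1) * ((t - N) ^ 2 - (t - N)) / 2 * t ^ (b - 2))) t := by
  have hb1 : 1 + b ≠ 0 := fun h => hb (by linarith)
  have h1 := (Real.hasDerivAt_rpow_const (x := t) (p := 1 + b) (Or.inl ht.ne')).div_const (1 + b)
  have h2 := Real.hasDerivAt_rpow_const (x := t) (p := b) (Or.inl ht.ne')
  have h3 := Real.hasDerivAt_rpow_const (x := t) (p := b - 1) (Or.inl ht.ne')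
  have h4 : HasDerivAt (fun t : ℝ => t - N) 1 t := (hasDerivAt_id t).sub_const N
  have h5 := (h1.neg.add ((h4.sub_const (1 / 2)).mul h2)).sub
    (((((h4.pow 2).sub h4).const_mul b).div_const 2).mul h3)
  refine h5.congr_deriv ?_
  rw [show 1 + b - 1 = b by ring, show b - 1 - 1 = b - 2 by ring]
  field_simp
  push_cast
  simp only [Pi.sub_apply, Pi.pow_apply]
  ring

/-- Since `|u² - u| ≤ 1/4` on `[0, 1]`, the derivative is dominated by that of the right-hand side,
a form chosen to telescope over consecutive intervals. -/
lemma abs_eulerMaclaurinAux_sub_le {b N t : ℝ} (hb : b ≠ -1) (hb1 : b < 1) (hN : 0 < N)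
    (h1 : N ≤ t) (h2 : t ≤ N + 1) :
    |eulerMaclaurinAux b N t - eulerMaclaurinAux b N N| ≤
      |b| / 8 * (N ^ (b - 1) - t ^ (b - 1)) := by
  have hB : ∀ s, 0 < s → HasDerivAt (fun s : ℝ => |b| / 8 * (N ^ (b - 1) - s ^ (b - 1)))
      (|b| / 8 * ((1 - b) * s ^ (b - 2))) s := by
    intro s hs
    have := ((Real.hasDerivAt_rpow_const (x := s) (p := b - 1) (Or.inl hs.ne')).const_sub
      (N ^ (b - 1))).const_mul (|b| / 8)
    refine this.congr_deriv ?_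
    rw [show b - 1 - 1 = b - 2 by ring]
    ring
  have hf : ∀ s, 0 < s → HasDerivAt
      (fun s => eulerMaclaurinAux b N s - eulerMaclaurinAux b N N)
      (-(b * (b - 1) * ((s - N) ^ 2 - (s - N)) / 2 * s ^ (b - 2))) s :=
    fun s hs => (hasDerivAt_eulerMaclaurinAux hb N hs).sub_const _
  have key := image_norm_le_of_norm_deriv_right_le_deriv_boundary' (a := N) (b := N + 1)
    (fun s hs => (hf s (hN.trans_le hs.1)).continuousAt.continuousWithinAt)
    (fun s hs => (hf s (hN.trans_le hs.1)).hasDerivWithinAt)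
    (B := fun s : ℝ => |b| / 8 * (N ^ (b - 1) - s ^ (b - 1))) (by simp)
    (fun s hs => (hB s (hN.trans_le hs.1)).continuousAt.continuousWithinAt)
    (fun s hs => (hB s (hN.trans_le hs.1)).hasDerivWithinAt)
    (fun s hs => by
      have hs0 : 0 < s := hN.trans_le hs.1
      have hw : 0 < s ^ (b - 2) := by positivity
      have e1 : |(s - N) ^ 2 - (s - N)| ≤ 1 / 4 := by
        have := hs.1
        have := hs.2
        rw [abs_le]
        constructor <;> nlinarith [sq_nonneg (s - N - 1 / 2)]
      rw [Real.norm_eq_abs, abs_neg, abs_mul, abs_div, abs_mul, abs_mul, abs_of_pos hw,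
        abs_of_neg (show b - 1 < 0 by linarith), abs_two]
      have e2 : |b| * -(b - 1) * |(s - N) ^ 2 - (s - N)| ≤ |b| * -(b - 1) * (1 / 4) :=
        mul_le_mul_of_nonneg_left e1 (mul_nonneg (abs_nonneg b) (by linarith))
      calc _ ≤ |b| * -(b - 1) * (1 / 4) / 2 * s ^ (b - 2) := by gcongr
        _ = _ := by ring)
  exact key ⟨h1, h2⟩

/-- Euler–Maclaurin summation for `∑ n ^ b`, to second order. -/
theorem exists_powSum_asymp {b : ℝ} (hb : b ≠ -1) (hb1 : b < 1) :
    ∃ c C : ℝ, 0 ≤ C ∧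
      Tendsto (fun N : ℕ => powSum b N - (N : ℝ) ^ (1 + b) / (1 + b) - (N : ℝ) ^ b / 2)
        atTop (𝓝 c) ∧
      ∀ y : ℝ, 1 ≤ y →
        |powSum b y - (y ^ (1 + b) / (1 + b) + c - sawtooth y * y ^ b)| ≤ C * y ^ (b - 1) := by
  set K := |b| / 8 with hK
  have hK0 : 0 ≤ K := by positivity
  set T : ℕ → ℝ := fun N => powSum b N - (N : ℝ) ^ (1 + b) / (1 + b) - (N : ℝ) ^ b / 2 with hT
  -- The sequence `T` takes its values at `N` and `N + 1` from the two ends of the same auxiliary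
  -- function, so its steps are the increments just bounded.
  have hT1 : ∀ N : ℕ, T N = powSum b N + eulerMaclaurinAux b N N := by
    intro N; simp only [hT, eulerMaclaurinAux]; ring
  have hT2 : ∀ N : ℕ, T (N + 1) = powSum b N + eulerMaclaurinAux b N (N + 1) := by
    intro N
    simp only [hT, eulerMaclaurinAux, powSum, Nat.floor_natCast,
      Finset.sum_Icc_succ_top (Nat.le_add_left 1 N)]
    push_cast
    ring
  have hstep : ∀ N : ℕ, 1 ≤ N →
      |T (N + 1) - T N| ≤ K * ((N : ℝ) ^ (b - 1) - ((N + 1 : ℕ) : ℝ) ^ (b - 1)) := by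
    intro N hN
    rw [hT2, hT1, add_sub_add_left_eq_sub]
    have := abs_eulerMaclaurinAux_sub_le (N := N) (t := N + 1) hb hb1 (by exact_mod_cast hN)
      (by linarith) le_rfl
    push_cast
    exact this
  have hdist : ∀ N M : ℕ, 1 ≤ N → N ≤ M →
      |T M - T N| ≤ K * ((N : ℝ) ^ (b - 1) - (M : ℝ) ^ (b - 1)) := by
    intro N M hN hM
    induction M, hM using Nat.le_induction with
    | base => simp
    | succ M hM ih =>
      have h1 := hstep M (hN.trans hM)
      have h2 := abs_add_le (T (M + 1) - T M) (T M - T N)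
      rw [sub_add_sub_cancel] at h2
      linarith
  have hdist' : ∀ N M : ℕ, 1 ≤ N → N ≤ M → |T M - T N| ≤ K * (N : ℝ) ^ (b - 1) := by
    intro N M hN hM
    have h1 := hdist N M hN hM
    have h2 : 0 ≤ K * (M : ℝ) ^ (b - 1) := by positivity
    linarith
  have hlim0 : Tendsto (fun N : ℕ => K * ((N + 1 : ℕ) : ℝ) ^ (b - 1)) atTop (𝓝 0) := by
    have h1 := (tendsto_rpow_neg_atTop (y := 1 - b) (by linarith)).const_mul K
    rw [mul_zero, neg_sub] at h1
    exact h1.comp (tendsto_natCast_atTop_atTop.comp (tendsto_add_atTop_nat 1))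
  have hcauchy : CauchySeq fun N => T (N + 1) :=
    cauchySeq_of_le_tendsto_0' _ (fun N M h => by
      rw [Real.dist_eq, abs_sub_comm]
      exact hdist' (N + 1) (M + 1) (by omega) (by omega)) hlim0
  obtain ⟨c, hc'⟩ := cauchySeq_tendsto_of_complete hcauchy
  have hc : Tendsto T atTop (𝓝 c) := (tendsto_add_atTop_iff_nat 1).1 hc'
  have hTc : ∀ N : ℕ, 1 ≤ N → |T N - c| ≤ K * (N : ℝ) ^ (b - 1) := by
    intro N hN
    rw [abs_sub_comm]
    refine le_of_tendsto ((hc.sub_const _).abs) ?_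
    filter_upwards [eventually_ge_atTop N] with M hM using hdist' N M hN hM
  refine ⟨c, 3 * K * 2 ^ (1 - b), by positivity, hc, ?_⟩
  intro y hy
  have hy0 : 0 < y := by linarith
  set N := ⌊y⌋₊ with hN
  have hN1 : 1 ≤ N := (Nat.one_le_floor_iff y).2 hy
  have hN1' : (1 : ℝ) ≤ N := by exact_mod_cast hN1
  have hNy : (N : ℝ) ≤ y := Nat.floor_le hy0.le
  have hyN : y < N + 1 := Nat.lt_floor_add_one y
  have hsaw : sawtooth y = y - N - 1 / 2 := by
    rw [sawtooth, Int.fract, ← natCast_floor_eq_intCast_floor hy0.le]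
  have h1 := abs_eulerMaclaurinAux_sub_le (N := N) (t := y) hb hb1 (by linarith) hNy hyN.le
  have h2 := hTc N hN1
  have h3 : |b * ((y - N) ^ 2 - (y - N)) / 2 * y ^ (b - 1)| ≤ K * y ^ (b - 1) := by
    have e1 : |(y - N) ^ 2 - (y - N)| ≤ 1 / 4 := by
      rw [abs_le]
      constructor <;> nlinarith [sq_nonneg (y - N - 1 / 2)]
    rw [abs_mul, abs_of_pos (by positivity : 0 < y ^ (b - 1)), abs_div, abs_mul, abs_two, hK]
    have e2 := mul_le_mul_of_nonneg_left e1 (abs_nonneg b)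
    exact mul_le_mul_of_nonneg_right (by linarith) (by positivity)
  -- For `y ≥ 1` the integer part is at least `y / 2`; this is the source of `2 ^ (1 - b)`.
  have h4 : (N : ℝ) ^ (b - 1) ≤ 2 ^ (1 - b) * y ^ (b - 1) := by
    calc (N : ℝ) ^ (b - 1) ≤ (y / 2) ^ (b - 1) :=
          Real.rpow_le_rpow_of_nonpos (by positivity) (by linarith) (by linarith)
      _ = _ := by
        rw [Real.div_rpow hy0.le (by norm_num), ← neg_sub b 1, Real.rpow_neg (by norm_num)]
        field_simp
  have h5 : y ^ (b - 1) ≤ (N : ℝ) ^ (b - 1) :=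
    Real.rpow_le_rpow_of_nonpos (by positivity) hNy (by linarith)
  have hS : powSum b (N : ℝ) = powSum b y := by rw [powSum, powSum, Nat.floor_natCast]
  have e : powSum b y - (y ^ (1 + b) / (1 + b) + c - sawtooth y * y ^ b) =
      (T N - c) + (eulerMaclaurinAux b N y - eulerMaclaurinAux b N N) +
        b * ((y - N) ^ 2 - (y - N)) / 2 * y ^ (b - 1) := by
    rw [hT1, hS, hsaw]
    simp only [eulerMaclaurinAux]
    ring
  rw [e]
  refine (abs_add_le _ _).trans ((add_le_add_left (abs_add_le _ _) _).trans ?_)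
  have h6 : 0 ≤ y ^ (b - 1) := by positivity
  nlinarith [mul_le_mul_of_nonneg_left h4 hK0, mul_le_mul_of_nonneg_left h5 hK0, mul_nonneg hK0 h6]

/-! ### Identification of the Euler–Maclaurin constant with zeta -/

/-- The `m`-th term of a series for `1 - (s - 1) ζ(s)`. -/
noncomputable def zetaTerm (m : ℝ) (s : ℂ) : ℂ :=
  (1 - s) * (m : ℂ) ^ (-s) - (((m + 1 : ℝ) : ℂ) ^ (1 - s) - (m : ℂ) ^ (1 - s))

lemma hasDerivAt_ofReal_cpow {t : ℝ} (ht : 0 < t) (s : ℂ) :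
    HasDerivAt (fun t : ℝ => (t : ℂ) ^ s) (s * (t : ℂ) ^ (s - 1)) t := by
  have h := ((hasDerivAt_id (t : ℂ)).cpow_const (c := s)
    (Complex.ofReal_mem_slitPlane.2 ht)).comp_ofReal
  exact h.congr_deriv (by simp)

/-- The term is `1 - s` times the integral of `m ^ (-s) - t ^ (-s)` over `[m, m + 1]`; two mean
value estimates replace the integral. The decay gives convergence for `Re s > 0`, not only for `Re s
> 1`. -/
lemma norm_zetaTerm_le {m : ℝ} {s : ℂ} (hm : 0 < m) (hs : 0 < s.re) :
    ‖zetaTerm m s‖ ≤ ‖1 - s‖ * ‖s‖ * m ^ (-s.re - 1) := by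
  have h1 : ∀ t ∈ Set.Icc m (m + 1),
      ‖(t : ℂ) ^ (-s) - (m : ℂ) ^ (-s)‖ ≤ ‖s‖ * m ^ (-s.re - 1) := by
    intro t ht
    have := norm_image_sub_le_of_norm_deriv_le_segment' (C := ‖s‖ * m ^ (-s.re - 1))
      (fun u hu => (hasDerivAt_ofReal_cpow (hm.trans_le hu.1) (-s)).hasDerivWithinAt)
      (fun u hu => by
        rw [norm_mul, norm_neg, Complex.norm_cpow_eq_rpow_re_of_pos (hm.trans_le hu.1),
          Complex.sub_re, Complex.neg_re, Complex.one_re]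
        exact mul_le_mul_of_nonneg_left
          (Real.rpow_le_rpow_of_nonpos hm hu.1 (by linarith)) (norm_nonneg s)) t ht
    refine this.trans (mul_le_of_le_one_right (by positivity) ?_)
    linarith [ht.2]
  have h2 : ∀ t ∈ Set.Icc m (m + 1), HasDerivWithinAt
      (fun t : ℝ => (t : ℂ) ^ (1 - s) - (1 - s) * (m : ℂ) ^ (-s) * (t : ℂ))
      ((1 - s) * ((t : ℂ) ^ (-s) - (m : ℂ) ^ (-s))) (Set.Icc m (m + 1)) t := by
    intro t ht
    have h3 := (hasDerivAt_ofReal_cpow (hm.trans_le ht.1) (1 - s)).sub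
      ((hasDerivAt_id (t : ℂ)).comp_ofReal.const_mul ((1 - s) * (m : ℂ) ^ (-s)))
    refine (h3.congr_deriv ?_).hasDerivWithinAt
    rw [show 1 - s - 1 = -s by ring]
    ring
  have h3 := norm_image_sub_le_of_norm_deriv_le_segment' h2
    (C := ‖1 - s‖ * (‖s‖ * m ^ (-s.re - 1)))
    (fun t ht => by
      rw [norm_mul]
      exact mul_le_mul_of_nonneg_left (h1 t ⟨ht.1, ht.2.le⟩) (norm_nonneg _))
    (m + 1) ⟨by linarith, le_rfl⟩
  rw [add_sub_cancel_left, mul_one, ← mul_assoc] at h3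
  rw [← norm_neg]
  refine le_trans (le_of_eq ?_) h3
  congr 1
  rw [zetaTerm]
  push_cast
  ring

lemma differentiable_zetaTerm {m : ℝ} (hm : 0 < m) : Differentiable ℂ (zetaTerm m) := by
  have h1 : (m : ℂ) ≠ 0 := Complex.ofReal_ne_zero.2 hm.ne'
  have h2 : ((m + 1 : ℝ) : ℂ) ≠ 0 := Complex.ofReal_ne_zero.2 (by linarith)
  unfold zetaTerm
  intro s
  have e1 : DifferentiableAt ℂ (fun s : ℂ => (m : ℂ) ^ (-s)) s :=
    DifferentiableAt.const_cpow (by fun_prop) (Or.inl h1)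
  have e2 : DifferentiableAt ℂ (fun s : ℂ => ((m + 1 : ℝ) : ℂ) ^ (1 - s)) s :=
    DifferentiableAt.const_cpow (by fun_prop) (Or.inl h2)
  have e3 : DifferentiableAt ℂ (fun s : ℂ => (m : ℂ) ^ (1 - s)) s :=
    DifferentiableAt.const_cpow (by fun_prop) (Or.inl h1)
  fun_prop

lemma sum_range_zetaTerm (s : ℂ) (N : ℕ) :
    ∑ n ∈ Finset.range N, zetaTerm (n + 1) s =
      (1 - s) * ∑ n ∈ Finset.range N, ((n + 1 : ℝ) : ℂ) ^ (-s) - ((N + 1 : ℝ) : ℂ) ^ (1 - s) + 1 := by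
  induction N with
  | zero => simp
  | succ N ih =>
    rw [Finset.sum_range_succ, ih, Finset.sum_range_succ, zetaTerm]
    push_cast
    ring

lemma summable_nat_add_one_rpow {a : ℝ} (ha : 0 < a) :
    Summable fun n : ℕ => ((n : ℝ) + 1) ^ (-a - 1) := by
  have h := (summable_nat_add_iff 1).2 (Real.summable_nat_rpow.2 (show -a - 1 < -1 by linarith))
  simpa using h

lemma summable_zetaTerm {s : ℂ} (hs : 0 < s.re) : Summable fun n : ℕ => zetaTerm (n + 1) s :=
  Summable.of_norm_bounded ((summable_nat_add_one_rpow hs).mul_left (‖1 - s‖ * ‖s‖))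
    fun n => norm_zetaTerm_le (by positivity) hs

lemma tendsto_natCast_add_one_cpow_zero {s : ℂ} (hs : s.re < 0) :
    Tendsto (fun N : ℕ => ((N + 1 : ℝ) : ℂ) ^ s) atTop (𝓝 0) := by
  rw [tendsto_zero_iff_norm_tendsto_zero]
  have h1 := tendsto_rpow_neg_atTop (y := -s.re) (by linarith)
  rw [neg_neg] at h1
  refine (h1.comp (tendsto_natCast_atTop_atTop.comp (tendsto_add_atTop_nat 1))).congr fun N => ?_
  rw [Complex.norm_cpow_eq_rpow_re_of_pos (by positivity)]
  simp

lemma tsum_zetaTerm_of_one_lt {s : ℂ} (hs : 1 < s.re) :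
    ∑' n : ℕ, zetaTerm (n + 1) s = 1 - riemannZeta₁ s := by
  have hs1 : s ≠ 1 := by rintro rfl; simp at hs
  have h1 := (summable_zetaTerm (s := s) (by linarith)).hasSum.tendsto_sum_nat
  have hsum : Summable fun n : ℕ => 1 / ((n : ℂ) + 1) ^ s := by
    have := (summable_nat_add_iff 1).2 (Complex.summable_one_div_nat_cpow.2 hs)
    simpa using this
  have h2 := hsum.hasSum.tendsto_sum_nat
  rw [← zeta_eq_tsum_one_div_nat_add_one_cpow hs] at h2
  have h3 := ((h2.const_mul (1 - s)).sub
    (tendsto_natCast_add_one_cpow_zero (s := 1 - s) (by simpa using hs))).add_const 1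
  have h4 := tendsto_nhds_unique h1 (h3.congr fun N => by
    rw [sum_range_zetaTerm]
    simp [Complex.cpow_neg])
  rw [h4, riemannZeta_eq_inv_sub_mul hs1]
  have : s - 1 ≠ 0 := sub_ne_zero.2 hs1
  field_simp
  ring

/-- Analytic continuation from a neighbourhood of 2, where the Dirichlet series is available. -/
lemma tsum_zetaTerm {s : ℂ} (hs : 0 < s.re) :
    ∑' n : ℕ, zetaTerm (n + 1) s = 1 - riemannZeta₁ s := by
  -- The half-plane keeps the decay exponent uniform and the ball bounds the factors `‖1 - s‖` and
  -- `‖s‖`; `a` and `R` are chosen so that both `s` and 2 lie in the convex set `U`.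
  set a := min (s.re / 2) 1 with ha
  set R := ‖s‖ + 3 with hR
  have ha0 : 0 < a := lt_min (by linarith) one_pos
  set U : Set ℂ := {z | a < z.re} ∩ Metric.ball 0 R with hU
  have hUo : IsOpen U := (isOpen_lt continuous_const Complex.continuous_re).inter Metric.isOpen_ball
  have hUc : Convex ℝ U := (convex_halfSpace_re_gt a).inter (convex_ball 0 R)
  have hR0 : 0 < R := by positivity
  have hd : DifferentiableOn ℂ (fun z => ∑' n : ℕ, zetaTerm (n + 1) z) U := by
    refine Complex.differentiableOn_tsum_of_summable_norm
      (u := fun n : ℕ => (1 + R) * R * ((n : ℝ) + 1) ^ (-a - 1))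
      ((summable_nat_add_one_rpow ha0).mul_left _)
      (fun n => (differentiable_zetaTerm (by positivity)).differentiableOn) hUo ?_
    rintro n w ⟨hw1, hw2⟩
    have hw1' : a < w.re := hw1
    rw [mem_ball_zero_iff] at hw2
    refine (norm_zetaTerm_le (by positivity) (ha0.trans hw1)).trans ?_
    have e1 : ‖1 - w‖ ≤ 1 + R := by
      refine (norm_sub_le _ _).trans ?_
      rw [norm_one]
      linarith
    have e2 : ((n : ℝ) + 1) ^ (-w.re - 1) ≤ ((n : ℝ) + 1) ^ (-a - 1) :=
      Real.rpow_le_rpow_of_exponent_le (by linarith [Nat.cast_nonneg (α := ℝ) n]) (by linarith)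
    gcongr
  have h2 : (2 : ℂ) ∈ U := by
    refine ⟨?_, ?_⟩
    · show a < (2 : ℂ).re
      have := min_le_right (s.re / 2) 1
      rw [Complex.re_ofNat]
      linarith
    · rw [mem_ball_zero_iff, Complex.norm_ofNat]
      linarith [norm_nonneg s]
  have hsU : s ∈ U := by
    refine ⟨?_, ?_⟩
    · show a < s.re
      have := min_le_left (s.re / 2) 1
      linarith
    · rw [mem_ball_zero_iff]
      linarith
  have hev : (fun z => ∑' n : ℕ, zetaTerm (n + 1) z) =ᶠ[𝓝 2] fun z => 1 - riemannZeta₁ z := by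
    filter_upwards [(isOpen_lt continuous_const Complex.continuous_re).mem_nhds
      (show (1 : ℝ) < (2 : ℂ).re by norm_num)] with z hz using tsum_zetaTerm_of_one_lt hz
  exact (hd.analyticOnNhd hUo).eqOn_of_preconnected_of_eventuallyEq
    ((differentiable_riemannZeta₁.const_sub 1).differentiableOn.analyticOnNhd hUo)
    hUc.isPreconnected h2 hev hsU

lemma powSum_eq_sum_range (b : ℝ) (N : ℕ) :
    powSum b N = ∑ n ∈ Finset.range N, ((n : ℝ) + 1) ^ b := by
  rw [powSum, Nat.floor_natCast, ← Finset.Ico_succ_right_eq_Icc, Finset.sum_Ico_eq_sum_range]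
  refine Finset.sum_congr (by simp) fun n _ => ?_
  push_cast
  rw [add_comm]

lemma riemannZeta_eq_of_tendsto {s c : ℝ} (hs : 0 < s) (hs1 : s ≠ 1)
    (hc : Tendsto (fun N : ℕ => powSum (-s) N - (N : ℝ) ^ (1 + -s) / (1 + -s) - (N : ℝ) ^ (-s) / 2)
      atTop (𝓝 c)) : riemannZeta (s : ℂ) = (c : ℂ) := by
  have hs1' : 1 + -s ≠ 0 := fun h => hs1 (by linarith)
  have hsC : (s : ℂ) ≠ 1 := by exact_mod_cast hs1
  have h1 := (summable_zetaTerm (s := (s : ℂ)) (by simpa using hs)).hasSum.tendsto_sum_nat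
  rw [tsum_zetaTerm (by simpa using hs)] at h1
  have h2 : Tendsto (fun N : ℕ => ((N + 1 : ℕ) : ℝ) ^ (-s)) atTop (𝓝 0) :=
    (tendsto_rpow_neg_atTop hs).comp (tendsto_natCast_atTop_atTop.comp (tendsto_add_atTop_nat 1))
  -- The series needs the power sum up to `N` but the boundary power at `N + 1`. Together with the
  -- half term already in the hypothesis, the extra half removes the last summand.
  have h3 := (((hc.comp (tendsto_add_atTop_nat 1)).const_mul (1 + -s)).sub
    (h2.const_mul ((1 + -s) / 2))).add_const 1
  have h4 : Tendsto (fun N : ℕ => (((1 + -s) * powSum (-s) N - ((N : ℝ) + 1) ^ (1 + -s) + 1 : ℝ) : ℂ))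
      atTop (𝓝 (((1 + -s) * c - (1 + -s) / 2 * 0 + 1 : ℝ) : ℂ)) := by
    refine (Complex.continuous_ofReal.tendsto _).comp (h3.congr fun N => ?_)
    simp only [Function.comp_apply]
    rw [powSum_eq_sum_range, Finset.sum_range_succ, ← powSum_eq_sum_range]
    push_cast
    field_simp
    ring
  have h5 := tendsto_nhds_unique h1 (h4.congr fun N => by
    rw [sum_range_zetaTerm, powSum_eq_sum_range]
    have e1 : ∀ n : ℕ, ((n + 1 : ℝ) : ℂ) ^ (-(s : ℂ)) = ((((n : ℝ) + 1) ^ (-s) : ℝ) : ℂ) := by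
      intro n
      rw [Complex.ofReal_cpow (by positivity), Complex.ofReal_neg]
    have e2 : ((N + 1 : ℝ) : ℂ) ^ (1 - (s : ℂ)) = ((((N : ℝ) + 1) ^ (1 + -s) : ℝ) : ℂ) := by
      rw [Complex.ofReal_cpow (by positivity)]
      push_cast
      rw [sub_eq_add_neg]
    simp only [e1]
    rw [e2]
    push_cast
    ring)
  rw [riemannZeta_eq_inv_sub_mul hsC]
  have hs2 : (s : ℂ) - 1 ≠ 0 := sub_ne_zero.2 hsC
  push_cast at h5
  field_simp
  linear_combination -h5

/-! ### Dirichlet's hyperbola method -/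

lemma sum_Ioc_sum_divisors_eq (f : ℕ → ℝ) (X : ℕ) :
    ∑ n ∈ Finset.Ioc 0 X, ∑ d ∈ n.divisors, f d =
      ∑ e ∈ Finset.Ioc 0 X, ∑ d ∈ Finset.Ioc 0 X, if d * e ≤ X then f d else 0 := by
  have h1 : ∀ n ∈ Finset.Ioc 0 X, ∑ d ∈ n.divisors, f d =
      ∑ p ∈ Finset.Ioc 0 X ×ˢ Finset.Ioc 0 X, if p.1 * p.2 = n then f p.1 else 0 := by
    intro n hn
    rw [Finset.mem_Ioc] at hn
    rw [← Nat.sum_divisorsAntidiagonal (fun d _ => f d), Nat.divisorsAntidiagonal_eq_prod_filter_of_le hn.1.ne' hn.2,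
      Finset.sum_filter]
  rw [Finset.sum_congr rfl h1, Finset.sum_comm, Finset.sum_product, Finset.sum_comm]
  refine Finset.sum_congr rfl fun e he => Finset.sum_congr rfl fun d hd => ?_
  rw [Finset.mem_Ioc] at he hd
  rw [Finset.sum_ite_eq]
  simp [Nat.mul_pos hd.1 he.1]

/-- Dirichlet's hyperbola method. -/
lemma sum_Ioc_sum_divisors_hyperbola (f : ℕ → ℝ) {X K : ℕ} (h1 : K * K ≤ X)
    (h2 : X < (K + 1) * (K + 1)) :
    ∑ n ∈ Finset.Ioc 0 X, ∑ d ∈ n.divisors, f d =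
      ∑ e ∈ Finset.Ioc 0 K, ∑ d ∈ Finset.Ioc 0 (X / e), f d +
        ∑ d ∈ Finset.Ioc 0 K, f d * (((X / d : ℕ) : ℝ) - K) := by
  have hKX : K ≤ X := (Nat.le_mul_self K).trans h1
  rw [sum_Ioc_sum_divisors_eq, ← Finset.sum_Ioc_consecutive _ (Nat.zero_le K) hKX]
  congr 1
  · refine Finset.sum_congr rfl fun e he => ?_
    rw [Finset.mem_Ioc] at he
    rw [← Finset.sum_filter]
    refine Finset.sum_congr ?_ fun _ _ => rfl
    ext d
    simp only [Finset.mem_filter, Finset.mem_Ioc, Nat.le_div_iff_mul_le he.1]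
    exact ⟨fun h => ⟨h.1.1, h.2⟩, fun h => ⟨⟨h.1, (Nat.le_mul_of_pos_right d he.1).trans h.2⟩, h.2⟩⟩
  -- A pair with `e > K` and `d * e ≤ X` must have `d ≤ K`; for such `d`, the cofactor `e` runs over
  -- `(K, X / d]`.
  · rw [Finset.sum_comm, ← Finset.sum_Ioc_consecutive _ (Nat.zero_le K) hKX]
    rw [Finset.sum_eq_zero (s := Finset.Ioc K X), add_zero]
    · refine Finset.sum_congr rfl fun d hd => ?_
      rw [Finset.mem_Ioc] at hd
      have hK : K ≤ X / d :=
        (Nat.le_div_iff_mul_le hd.1).2 ((Nat.mul_le_mul_left K hd.2).trans h1)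
      have h3 : (Finset.Ioc K X).filter (fun e => d * e ≤ X) = Finset.Ioc K (X / d) := by
        ext e
        simp only [Finset.mem_filter, Finset.mem_Ioc, Nat.le_div_iff_mul_le hd.1, mul_comm e d]
        exact ⟨fun h => ⟨h.1.1, h.2⟩,
          fun h => ⟨⟨h.1, (Nat.le_mul_of_pos_left e hd.1).trans h.2⟩, h.2⟩⟩
      rw [← Finset.sum_filter, h3, Finset.sum_const, Nat.card_Ioc, nsmul_eq_mul, Nat.cast_sub hK,
        mul_comm]
    · intro d hd
      refine Finset.sum_eq_zero fun e he => if_neg ?_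
      rw [Finset.mem_Ioc] at hd he
      exact not_le.2 (h2.trans_le (Nat.mul_le_mul (by omega) (by omega)))

lemma floor_sqrt_bounds {x : ℝ} (hx : 0 ≤ x) :
    ⌊√x⌋₊ * ⌊√x⌋₊ ≤ ⌊x⌋₊ ∧ ⌊x⌋₊ < (⌊√x⌋₊ + 1) * (⌊√x⌋₊ + 1) := by
  have h0 := Real.sqrt_nonneg x
  have h1 := Nat.floor_le h0
  have h2 := Nat.lt_floor_add_one √x
  have h3 := Real.mul_self_sqrt hx
  constructor
  · rw [Nat.le_floor_iff hx]
    push_cast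
    nlinarith
  · rw [Nat.floor_lt hx]
    push_cast
    nlinarith

lemma natCast_floor_eq {y : ℝ} (hy : 0 ≤ y) : (⌊y⌋₊ : ℝ) = y - sawtooth y - 1 / 2 := by
  rw [sawtooth, Int.fract, natCast_floor_eq_intCast_floor hy]
  ring

lemma powSum_eq_sum_Ioc (b y : ℝ) : powSum b y = ∑ n ∈ Finset.Ioc 0 ⌊y⌋₊, (n : ℝ) ^ b := by
  rw [powSum]
  rfl

lemma sum_fracSigma_eq (a : ℝ) {x : ℝ} (hx : 0 ≤ x) :
    ∑ n ∈ Finset.Icc 1 ⌊x⌋₊, fracSigma a n =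
      ∑ e ∈ Finset.Ioc 0 ⌊√x⌋₊, powSum a (x / e) +
        ∑ d ∈ Finset.Ioc 0 ⌊√x⌋₊, (d : ℝ) ^ a * (x / d - sawtooth (x / d) - 1 / 2 - ⌊√x⌋₊) := by
  obtain ⟨h1, h2⟩ := floor_sqrt_bounds hx
  have h := sum_Ioc_sum_divisors_hyperbola (fun d => (d : ℝ) ^ a) h1 h2
  refine h.trans ?_
  congr 1
  · refine Finset.sum_congr rfl fun e _ => ?_
    rw [powSum_eq_sum_Ioc, Nat.floor_div_natCast]
  · refine Finset.sum_congr rfl fun d _ => ?_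
    rw [← Nat.floor_div_natCast, natCast_floor_eq (by positivity)]

/-! ### Partial summation and weighted sawtooth sums -/

/-- Summation by parts with an antitone weight. -/
lemma abs_sum_mul_sub_le_of_antitone {w u : ℕ → ℝ} {m : ℕ} {M : ℝ} (l : ℕ) (hl : m ≤ l)
    (hw : ∀ j, m ≤ j → j < l → w (j + 1) ≤ w j)
    (hu : ∀ n, n ≤ l → |∑ j ∈ Finset.Ico m n, u j| ≤ M) :
    |∑ j ∈ Finset.Ico m (l + 1), w j * u j - w l * ∑ j ∈ Finset.Ico m (l + 1), u j| ≤
      (w m - w l) * M := by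
  induction l, hl using Nat.le_induction with
  | base => simp
  | succ l hl ih =>
    have h1 := ih (fun j h1 h2 => hw j h1 (by omega)) (fun n hn => hu n (by omega))
    rw [Finset.sum_Ico_succ_top (by omega) (fun j => w j * u j),
      Finset.sum_Ico_succ_top (b := l + 1) (by omega) u]
    have h2 := hw l hl (by omega)
    have h3 := mul_le_mul_of_nonneg_left (hu (l + 1) le_rfl) (sub_nonneg.2 h2)
    rw [← abs_of_nonneg (sub_nonneg.2 h2), ← abs_mul, abs_of_nonneg (sub_nonneg.2 h2)] at h3
    have h4 := abs_add_le (∑ j ∈ Finset.Ico m (l + 1), w j * u j -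
      w l * ∑ j ∈ Finset.Ico m (l + 1), u j) ((w l - w (l + 1)) * ∑ j ∈ Finset.Ico m (l + 1), u j)
    refine (le_of_eq ?_).trans (h4.trans ((add_le_add h1 h3).trans (le_of_eq ?_)))
    · congr 1
      ring
    · ring

lemma abs_sum_mul_le_of_antitone {w u : ℕ → ℝ} {m n : ℕ} {M : ℝ} (hM : 0 ≤ M)
    (hw0 : ∀ j, m ≤ j → 0 ≤ w j) (hw : ∀ j, m ≤ j → w (j + 1) ≤ w j)
    (hu : ∀ k, k ≤ n → |∑ j ∈ Finset.Ico m k, u j| ≤ M) :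
    |∑ j ∈ Finset.Ico m n, w j * u j| ≤ w m * M := by
  rcases le_or_gt n m with h | h
  · rw [Finset.Ico_eq_empty_of_le h, Finset.sum_empty, abs_zero]
    exact mul_nonneg (hw0 m le_rfl) hM
  · obtain ⟨l, rfl⟩ : ∃ l, n = l + 1 := ⟨n - 1, by omega⟩
    have h1 := abs_sum_mul_sub_le_of_antitone (u := u) l (by omega) (fun j h _ => hw j h)
      (fun k hk => hu k (by omega))
    have h2 := mul_le_mul_of_nonneg_left (hu (l + 1) le_rfl) (hw0 l (by omega))
    rw [← abs_of_nonneg (hw0 l (by omega)), ← abs_mul, abs_of_nonneg (hw0 l (by omega))] at h2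
    have h3 := abs_add_le (∑ j ∈ Finset.Ico m (l + 1), w j * u j -
      w l * ∑ j ∈ Finset.Ico m (l + 1), u j) (w l * ∑ j ∈ Finset.Ico m (l + 1), u j)
    rw [sub_add_cancel] at h3
    linarith

lemma abs_sum_mul_le_of_monotone {w u : ℕ → ℝ} {m l : ℕ} {M : ℝ} (hM : 0 ≤ M) (hml : m ≤ l)
    (hw0 : ∀ j, m ≤ j → 0 ≤ w j) (hw : ∀ j, m ≤ j → w j ≤ w (j + 1))
    (hu : ∀ k, k ≤ l + 1 → |∑ j ∈ Finset.Ico m k, u j| ≤ M) :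
    |∑ j ∈ Finset.Ico m (l + 1), w j * u j| ≤ 2 * w l * M := by
  have h1 := abs_sum_mul_sub_le_of_antitone (w := fun j => -w j) (u := u) l hml
    (fun j h _ => neg_le_neg (hw j h)) (fun k hk => hu k (by omega))
  have h2 := mul_le_mul_of_nonneg_left (hu (l + 1) le_rfl) (hw0 l hml)
  rw [← abs_of_nonneg (hw0 l hml), ← abs_mul, abs_of_nonneg (hw0 l hml)] at h2
  have h3 := abs_add_le (∑ j ∈ Finset.Ico m (l + 1), w j * u j -
    w l * ∑ j ∈ Finset.Ico m (l + 1), u j) (w l * ∑ j ∈ Finset.Ico m (l + 1), u j)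
  rw [sub_add_cancel] at h3
  have h4 : ∑ j ∈ Finset.Ico m (l + 1), -w j * u j - -w l * ∑ j ∈ Finset.Ico m (l + 1), u j =
      -(∑ j ∈ Finset.Ico m (l + 1), w j * u j - w l * ∑ j ∈ Finset.Ico m (l + 1), u j) := by
    simp only [neg_mul, Finset.sum_neg_distrib]
    ring
  rw [h4, abs_neg] at h1
  have h5 := mul_nonneg (hw0 m le_rfl) hM
  linarith

lemma Ioc_zero_eq_Ico (K : ℕ) : Finset.Ioc 0 K = Finset.Ico 1 (K + 1) := by
  ext n
  simp only [Finset.mem_Ioc, Finset.mem_Ico]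
  omega

lemma natCast_sq_le_of_le_floor_sqrt {x : ℝ} (hx : 0 ≤ x) {n : ℕ} (hn : n ≤ ⌊√x⌋₊) :
    (n : ℝ) ^ 2 ≤ x := by
  have h1 : (n : ℝ) ≤ √x := (Nat.le_floor_iff (Real.sqrt_nonneg x)).1 hn
  exact (Real.le_sqrt (Nat.cast_nonneg n) hx).1 h1

lemma abs_sum_rpow_mul_sawtooth_le {a η : ℝ} (ha : 0 < a) (hη : 0 < η) (hη1 : η ≤ 1) :
    ∃ C : ℝ, 0 ≤ C ∧ ∀ x : ℝ, 1 ≤ x →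
      |∑ d ∈ Finset.Ioc 0 ⌊√x⌋₊, (d : ℝ) ^ a * sawtooth (x / d)| ≤
        C * x ^ (1 / 3 + a / 2 + η) := by
  obtain ⟨C, hC, hB⟩ := abs_sum_sawtooth_div_le hη hη1
  refine ⟨2 * C, by positivity, ?_⟩
  intro x hx
  have hx0 : 0 < x := by linarith
  set K := ⌊√x⌋₊ with hK
  have hK1 : 1 ≤ K := (Nat.one_le_floor_iff _).2 (Real.one_le_sqrt.2 hx)
  rw [Ioc_zero_eq_Ico]
  refine (abs_sum_mul_le_of_monotone (w := fun d : ℕ => (d : ℝ) ^ a) (u := fun d => sawtooth (x / d))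
    (M := C * x ^ (1 / 3 + η)) (by positivity) hK1 (fun j _ => by positivity)
    (fun j _ => Real.rpow_le_rpow (Nat.cast_nonneg j) (by push_cast; linarith) ha.le)
    (fun k hk => hB x k hx fun n hn => natCast_sq_le_of_le_floor_sqrt hx0.le (by omega))).trans ?_
  have h1 : (K : ℝ) ^ a ≤ x ^ (a / 2) := by
    calc (K : ℝ) ^ a ≤ (√x) ^ a :=
          Real.rpow_le_rpow (Nat.cast_nonneg _) (Nat.floor_le (Real.sqrt_nonneg x)) ha.le
      _ = x ^ (a / 2) := by
        rw [Real.sqrt_eq_rpow, ← Real.rpow_mul hx0.le]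
        congr 1
        ring
  rw [show 1 / 3 + a / 2 + η = a / 2 + (1 / 3 + η) by ring, Real.rpow_add hx0 (a / 2)]
  calc _ ≤ 2 * x ^ (a / 2) * (C * x ^ (1 / 3 + η)) := by gcongr
    _ = _ := by ring

lemma exists_powSum_le {a : ℝ} (ha : 0 < a) (ha1 : a < 1) :
    ∃ C : ℝ, 0 ≤ C ∧ ∀ y : ℝ, 1 ≤ y → powSum (-a) y ≤ C * y ^ (1 - a) := by
  obtain ⟨c, C, hC, -, h⟩ := exists_powSum_asymp (b := -a) (by linarith) (by linarith)
  have h1a : 0 < 1 - a := by linarith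
  refine ⟨1 / (1 - a) + |c| + 1 / 2 + C, by positivity, ?_⟩
  intro y hy
  have h1 := (abs_le.1 (h y hy)).2
  have h2 : 1 ≤ y ^ (1 - a) := Real.one_le_rpow hy h1a.le
  have h3 : y ^ (-a) ≤ 1 := Real.rpow_le_one_of_one_le_of_nonpos hy (by linarith)
  have h4 : y ^ (-a - 1) ≤ 1 := Real.rpow_le_one_of_one_le_of_nonpos hy (by linarith)
  have h5 : 0 < y ^ (-a) := by positivity
  have h6 := (abs_le.1 (abs_sawtooth_le y)).1
  have h7 := le_abs_self c
  rw [← sub_eq_add_neg] at h1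
  have h8 : C * y ^ (-a - 1) ≤ C := mul_le_of_le_one_right hC h4
  have h9 : |c| + 1 / 2 + C ≤ (|c| + 1 / 2 + C) * y ^ (1 - a) :=
    le_mul_of_one_le_right (by positivity) h2
  have h10 : -(sawtooth y * y ^ (-a)) ≤ 1 / 2 := by nlinarith
  have h11 : y ^ (1 - a) / (1 - a) = 1 / (1 - a) * y ^ (1 - a) := by ring
  linarith

/-- The sum is cut at `e = x ^ (1/3)`. Below the cut the trivial bound gives `x ^ a * x ^ ((1 -
a)/3)`; above it the weight is at most `x ^ (2a/3)` and partial summation applies. Up to `x ^ η` the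
two bounds agree, and this is the dominant part of the error term. -/
lemma abs_sum_div_rpow_mul_sawtooth_le {a η : ℝ} (ha : 0 < a) (ha1 : a < 1) (hη : 0 < η)
    (hη1 : η ≤ 1) :
    ∃ C : ℝ, 0 ≤ C ∧ ∀ x : ℝ, 1 ≤ x →
      |∑ e ∈ Finset.Ioc 0 ⌊√x⌋₊, (x / e) ^ a * sawtooth (x / e)| ≤
        C * x ^ (1 / 3 + 2 * a / 3 + η) := by
  obtain ⟨C, hC, hB⟩ := abs_sum_sawtooth_div_le hη hη1
  obtain ⟨C', hC', hP⟩ := exists_powSum_le ha ha1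
  refine ⟨C' + 2 * C, by positivity, ?_⟩
  intro x hx
  have hx0 : 0 < x := by linarith
  set K := ⌊√x⌋₊ with hK
  set y := x ^ (1 / 3 : ℝ) with hy
  have hy1 : 1 ≤ y := Real.one_le_rpow hx (by norm_num)
  set J := ⌊y⌋₊ with hJ
  have hJK : J ≤ K := by
    apply Nat.floor_le_floor
    rw [Real.sqrt_eq_rpow]
    exact Real.rpow_le_rpow_of_exponent_le hx (by norm_num)
  rw [← Finset.sum_Ioc_consecutive _ (Nat.zero_le J) hJK]
  refine (abs_add_le _ _).trans ?_
  have h1 : |∑ e ∈ Finset.Ioc 0 J, (x / e) ^ a * sawtooth (x / e)| ≤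
      C' * x ^ (1 / 3 + 2 * a / 3 + η) := by
    calc _ ≤ ∑ e ∈ Finset.Ioc 0 J, x ^ a * (e : ℝ) ^ (-a) := by
          refine (Finset.abs_sum_le_sum_abs _ _).trans (Finset.sum_le_sum fun e _ => ?_)
          have h2 : (0 : ℝ) ≤ (x / e) ^ a := by positivity
          rw [abs_mul, abs_of_nonneg h2, Real.rpow_neg (Nat.cast_nonneg e), ← div_eq_mul_inv,
            ← Real.div_rpow hx0.le (Nat.cast_nonneg e)]
          exact mul_le_of_le_one_right h2 ((abs_sawtooth_le _).trans (by norm_num))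
      _ = x ^ a * powSum (-a) y := by rw [← Finset.mul_sum, powSum_eq_sum_Ioc]
      _ ≤ x ^ a * (C' * y ^ (1 - a)) := by
          gcongr
          exact hP y hy1
      _ = C' * x ^ (1 / 3 + 2 * a / 3) := by
          rw [hy, ← Real.rpow_mul hx0.le, mul_left_comm, ← Real.rpow_add hx0]
          congr 2
          ring
      _ ≤ _ := mul_le_mul_of_nonneg_left
          (Real.rpow_le_rpow_of_exponent_le hx (by linarith)) hC'
  have h2 : |∑ e ∈ Finset.Ioc J K, (x / e) ^ a * sawtooth (x / e)| ≤
      2 * C * x ^ (1 / 3 + 2 * a / 3 + η) := by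
    have hIoc : Finset.Ioc J K = Finset.Ico (J + 1) (K + 1) := by
      ext n
      simp only [Finset.mem_Ioc, Finset.mem_Ico]
      omega
    have hpart : ∀ k, k ≤ K + 1 → |∑ e ∈ Finset.Ico 1 k, sawtooth (x / e)| ≤ C * x ^ (1 / 3 + η) :=
      fun k hk => hB x k hx fun n hn => natCast_sq_le_of_le_floor_sqrt hx0.le (by omega)
    rw [hIoc]
    refine (abs_sum_mul_le_of_antitone (w := fun e : ℕ => (x / e) ^ a)
      (u := fun e => sawtooth (x / e)) (M := 2 * (C * x ^ (1 / 3 + η))) (by positivity)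
      (fun j _ => by positivity) (fun j hj => ?_) (fun k hk => ?_)).trans ?_
    · have : (0 : ℝ) < j := by exact_mod_cast (by omega : 0 < j)
      refine Real.rpow_le_rpow (by positivity) ?_ ha.le
      gcongr
      omega
    · rcases le_or_gt k (J + 1) with h | h
      · rw [Finset.Ico_eq_empty_of_le h, Finset.sum_empty, abs_zero]
        positivity
      · have e1 := Finset.sum_Ico_consecutive (fun e : ℕ => sawtooth (x / e))
          (by omega : 1 ≤ J + 1) h.le
        have e2 := abs_le.1 (hpart k hk)
        have e3 := abs_le.1 (hpart (J + 1) (by omega))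
        rw [abs_le]
        constructor <;> linarith
    · have e1 : (x / ((J + 1 : ℕ) : ℝ)) ^ a ≤ x ^ (2 * a / 3) := by
        have e2 : y ≤ ((J + 1 : ℕ) : ℝ) := by
          push_cast
          exact (Nat.lt_floor_add_one y).le
        calc (x / ((J + 1 : ℕ) : ℝ)) ^ a ≤ (x / y) ^ a := by gcongr
          _ = x ^ (2 * a / 3) := by
            have : x / y = x ^ (2 / 3 : ℝ) := by
              nth_rw 1 [← Real.rpow_one x]
              rw [hy, ← Real.rpow_sub hx0]
              norm_num
            rw [this, ← Real.rpow_mul hx0.le]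
            congr 1
            ring
      rw [show 1 / 3 + 2 * a / 3 + η = 2 * a / 3 + (1 / 3 + η) by ring, Real.rpow_add hx0 (2 * a / 3)]
      calc _ ≤ x ^ (2 * a / 3) * (2 * (C * x ^ (1 / 3 + η))) := by gcongr
        _ = _ := by ring
  linarith

/-! ### The error term as sawtooth sums -/

/-- Euler–Maclaurin summation for `∑ n ^ (-s)` with the constant identified as `ζ(s)`. -/
lemma exists_powSum_neg_asymp {s : ℝ} (hs : 0 < s) (hs1 : s ≠ 1) :
    ∃ c C : ℝ, 0 ≤ C ∧ riemannZeta (s : ℂ) = (c : ℂ) ∧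
      ∀ y : ℝ, 1 ≤ y →
        |powSum (-s) y - (y ^ (1 + -s) / (1 + -s) + c - sawtooth y * y ^ (-s))| ≤
          C * y ^ (-s - 1) := by
  obtain ⟨c, C, hC, hc, h⟩ :=
    exists_powSum_asymp (b := -s) (fun h => hs1 (by linarith)) (by linarith)
  exact ⟨c, C, hC, riemannZeta_eq_of_tendsto hs hs1 hc, h⟩

/-- Collects what is left once the main terms cancel: `R` stands for `√x`, `u` for `R ^ a`, `p` for
the sawtooth at `R`, and `S`, `r0`, `r1`, `r2` for Euler–Maclaurin errors. Each piece is `O(u)`. -/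
lemma abs_sigmaError_remainder_le {a R u p c0 r0 r1 r2 S C0 C1 C2 : ℝ} (ha : 0 < a) (hR1 : 1 ≤ R)
    (hu1 : 1 ≤ u) (hpabs : |p| ≤ 1 / 2) (br : |S| ≤ C0 * u)
    (b0 : |r0| ≤ C0 * (u / R)) (b1 : |r1| ≤ C1 * (u⁻¹ / R ^ 2)) (b2 : |r2| ≤ C2 * (u / R ^ 2)) :
    |S + R ^ 2 * u ^ 2 / (1 + a) * r1 + R ^ 2 * r2 - (R - p) * r0 - c0 / 2 - p ^ 2 * u| ≤
      (C0 + C1 + C2 + 2 * C0 + |c0| + 1) * u := by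
  have ha10 : 0 < 1 + a := by linarith
  have hR0 : 0 < R := by linarith
  have hu0 : 0 < u := by linarith
  have g1 : |R ^ 2 * u ^ 2 / (1 + a) * r1| ≤ C1 * u := by
    have e3 : 0 ≤ R ^ 2 * u ^ 2 / (1 + a) := by positivity
    rw [abs_mul, abs_of_nonneg e3]
    calc _ ≤ R ^ 2 * u ^ 2 * (C1 * (u⁻¹ / R ^ 2)) := by
          refine mul_le_mul ?_ b1 (abs_nonneg _) (by positivity)
          exact div_le_self (by positivity) (by linarith)
      _ = _ := by field_simp
  have g2 : |R ^ 2 * r2| ≤ C2 * u := by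
    rw [abs_mul, abs_of_nonneg (by positivity : 0 ≤ R ^ 2)]
    calc _ ≤ R ^ 2 * (C2 * (u / R ^ 2)) := by gcongr
      _ = _ := by field_simp
  have hp2 := abs_le.1 hpabs
  have g3 : |(R - p) * r0| ≤ 2 * C0 * u := by
    rw [abs_mul]
    have e4 : |R - p| ≤ 2 * R := by
      rw [abs_le]
      constructor <;> linarith
    calc _ ≤ 2 * R * (C0 * (u / R)) := by gcongr
      _ = _ := by field_simp
  have g4 : |c0 / 2| ≤ |c0| * u := by
    rw [abs_div, abs_two]
    have := le_mul_of_one_le_right (abs_nonneg c0) hu1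
    linarith [abs_nonneg c0]
  have g5 : |p ^ 2 * u| ≤ u := by
    rw [abs_of_nonneg (by positivity)]
    exact mul_le_of_le_one_left hu0.le ((sq_le_one_iff_abs_le_one p).2 (by linarith))
  have := abs_le.1 br
  have := abs_le.1 g1
  have := abs_le.1 g2
  have := abs_le.1 g3
  have := abs_le.1 g4
  have := abs_le.1 g5
  rw [abs_le]
  constructor <;> linarith

/-- The error term is given by two sawtooth sums, up to `O(x ^ (a / 2))`. -/
lemma exists_sigmaError_eq {a : ℝ} (ha : 0 < a) (ha1 : a < 1) :
    ∃ C : ℝ, 0 ≤ C ∧ ∀ x : ℝ, 1 ≤ x → ∃ r : ℝ, |r| ≤ C * x ^ (a / 2) ∧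
      sigmaError a x = ((r - ∑ e ∈ Finset.Ioc 0 ⌊√x⌋₊, (x / e) ^ a * sawtooth (x / e)
        - ∑ d ∈ Finset.Ioc 0 ⌊√x⌋₊, (d : ℝ) ^ a * sawtooth (x / d) : ℝ) : ℂ) := by
  -- The constant `c0` need not be identified: the two halves of the hyperbola cancel it up to `-c0
  -- / 2`, which goes into the remainder.
  obtain ⟨c0, C0, hC0, -, h0⟩ := exists_powSum_asymp (b := a) (by linarith) ha1
  obtain ⟨c1, C1, hC1, hz1, h1⟩ := exists_powSum_neg_asymp (s := 1 + a) (by linarith) (by linarith)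
  obtain ⟨c2, C2, hC2, hz2, h2⟩ := exists_powSum_neg_asymp (s := 1 - a) (by linarith) (by linarith)
  have ha10 : 0 < 1 + a := by linarith
  refine ⟨C0 + C1 + C2 + 2 * C0 + |c0| + 1, by positivity, ?_⟩
  intro x hx
  have hx0 : 0 < x := by linarith
  set R := √x with hR
  have hR1 : 1 ≤ R := Real.one_le_sqrt.2 hx
  have hR0 : 0 < R := by linarith
  have hxR : x = R ^ 2 := (Real.sq_sqrt hx0.le).symm
  have hRpow : x ^ (a / 2) = R ^ a := by
    rw [hR, Real.sqrt_eq_rpow, ← Real.rpow_mul hx0.le]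
    congr 1
    ring
  set K := ⌊R⌋₊ with hK
  have hKR : (K : ℝ) ≤ R := Nat.floor_le hR0.le
  set p := sawtooth R with hp
  have hKeq : (K : ℝ) = R - p - 1 / 2 := natCast_floor_eq hR0.le
  have hpabs : |p| ≤ 1 / 2 := abs_sawtooth_le R
  set u := R ^ a with hu
  have hu1 : 1 ≤ u := Real.one_le_rpow hR1 ha.le
  have hu0 : 0 < u := by linarith
  have hRna : R ^ (-a) = u⁻¹ := Real.rpow_neg hR0.le a
  have hR1a : R ^ (1 + a) = R * u := by rw [Real.rpow_add hR0, Real.rpow_one]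
  have hx1a : x ^ (1 + a) = R ^ 2 * u ^ 2 := by
    rw [hxR, Real.rpow_add (by positivity), Real.rpow_one, ← Real.rpow_natCast R 2,
      ← Real.rpow_mul hR0.le, mul_comm _ a, Real.rpow_mul hR0.le, Real.rpow_natCast,
      Real.rpow_natCast]
  set r0 := powSum a R - (R ^ (1 + a) / (1 + a) + c0 - p * R ^ a) with hr0
  set r1 := powSum (-(1 + a)) R -
    (R ^ (1 + -(1 + a)) / (1 + -(1 + a)) + c1 - p * R ^ (-(1 + a))) with hr1
  set r2 := powSum (-(1 - a)) R -
    (R ^ (1 + -(1 - a)) / (1 + -(1 - a)) + c2 - p * R ^ (-(1 - a))) with hr2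
  set r : ℕ → ℝ := fun e => powSum a (x / e) -
    ((x / e) ^ (1 + a) / (1 + a) + c0 - sawtooth (x / e) * (x / e) ^ a) with hr
  have b0 : |r0| ≤ C0 * (u / R) := by
    have := h0 R hR1
    rwa [Real.rpow_sub hR0, Real.rpow_one] at this
  have b1 : |r1| ≤ C1 * (u⁻¹ / R ^ 2) := by
    have := h1 R hR1
    rwa [show -(1 + a) - 1 = -a - 2 by ring, Real.rpow_sub hR0 (-a), Real.rpow_two, hRna] at this
  have b2 : |r2| ≤ C2 * (u / R ^ 2) := by
    have := h2 R hR1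
    rwa [show -(1 - a) - 1 = a - 2 by ring, Real.rpow_sub hR0 a, Real.rpow_two] at this
  have br : |∑ e ∈ Finset.Ioc 0 K, r e| ≤ C0 * u := by
    have hterm : ∀ e ∈ Finset.Ioc 0 K, |r e| ≤ C0 * (u / R) := by
      intro e he
      rw [Finset.mem_Ioc] at he
      have he0 : (0 : ℝ) < e := by exact_mod_cast he.1
      have heR : (e : ℝ) ≤ R := le_trans (by exact_mod_cast he.2) hKR
      have hxe : R ≤ x / e := by
        rw [le_div_iff₀ he0, hxR]
        nlinarith
      refine (h0 (x / e) (hR1.trans hxe)).trans (mul_le_mul_of_nonneg_left ?_ hC0)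
      calc (x / e) ^ (a - 1) ≤ R ^ (a - 1) :=
            Real.rpow_le_rpow_of_nonpos hR0 hxe (by linarith)
        _ = _ := by rw [Real.rpow_sub hR0, Real.rpow_one]
    refine (Finset.abs_sum_le_sum_abs _ _).trans ((Finset.sum_le_sum hterm).trans ?_)
    rw [Finset.sum_const, Nat.card_Ioc, nsmul_eq_mul, Nat.sub_zero]
    calc (K : ℝ) * (C0 * (u / R)) ≤ R * (C0 * (u / R)) := by gcongr
      _ = _ := by field_simp
  set S1 := ∑ e ∈ Finset.Ioc 0 K, (x / e) ^ a * sawtooth (x / e) with hS1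
  set S2 := ∑ d ∈ Finset.Ioc 0 K, (d : ℝ) ^ a * sawtooth (x / d) with hS2
  have e1 : ∑ e ∈ Finset.Ioc 0 K, powSum a (x / e) =
      x ^ (1 + a) / (1 + a) * powSum (-(1 + a)) R + c0 * K - S1 + ∑ e ∈ Finset.Ioc 0 K, r e := by
    have hc : c0 * (K : ℝ) = ∑ e ∈ Finset.Ioc 0 K, c0 := by simp [mul_comm]
    rw [hc, powSum_eq_sum_Ioc, Finset.mul_sum, hS1, ← Finset.sum_add_distrib,
      ← Finset.sum_sub_distrib, ← Finset.sum_add_distrib]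
    refine Finset.sum_congr rfl fun e _ => ?_
    simp only [hr]
    rw [Real.div_rpow hx0.le (Nat.cast_nonneg e) (1 + a), Real.rpow_neg (Nat.cast_nonneg e)]
    ring
  -- Since `K = R - p - 1/2`, the halves cancel and the factor subtracted is `R - p`.
  have e2 : ∑ d ∈ Finset.Ioc 0 K, (d : ℝ) ^ a * (x / d - sawtooth (x / d) - 1 / 2 - K) =
      x * powSum (-(1 - a)) R - S2 - (R - p) * powSum a R := by
    rw [powSum_eq_sum_Ioc, powSum_eq_sum_Ioc, Finset.mul_sum, Finset.mul_sum, hS2,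
      ← Finset.sum_sub_distrib, ← Finset.sum_sub_distrib]
    refine Finset.sum_congr rfl fun d hd => ?_
    have hd0 : (0 : ℝ) < d := by exact_mod_cast (Finset.mem_Ioc.1 hd).1
    rw [hKeq, neg_sub, Real.rpow_sub hd0, Real.rpow_one]
    ring
  have f0 : powSum a R = R * u / (1 + a) + c0 - p * u + r0 := by
    rw [hr0, hR1a]; ring
  have f1 : powSum (-(1 + a)) R = u⁻¹ / -a + c1 - p * (u⁻¹ / R) + r1 := by
    rw [hr1, show 1 + -(1 + a) = -a by ring, show -(1 + a) = -a - 1 by ring, Real.rpow_sub hR0 (-a),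
      Real.rpow_one, hRna]
    ring
  have f2 : powSum (-(1 - a)) R = u / a + c2 - p * (u / R) + r2 := by
    rw [hr2, show 1 + -(1 - a) = a by ring, neg_sub, Real.rpow_sub hR0, Real.rpow_one]
    ring
  refine ⟨∑ e ∈ Finset.Ioc 0 K, r e + R ^ 2 * u ^ 2 / (1 + a) * r1 + R ^ 2 * r2 - (R - p) * r0
    - c0 / 2 - p ^ 2 * u, ?_, ?_⟩
  · rw [hRpow]
    exact abs_sigmaError_remainder_le ha hR1 hu1 hpabs br b0 b1 b2
  · have hz1' : riemannZeta (1 + (a : ℂ)) = c1 := by rw [← hz1]; push_cast; rfl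
    have hz2' : riemannZeta (1 - (a : ℂ)) = c2 := by rw [← hz2]; push_cast; rfl
    rw [sigmaError, hz1', hz2', sum_fracSigma_eq a hx0.le, ← hR, ← hK, e1, e2, f0, f1, f2, hx1a,
      ← Complex.ofReal_mul, ← Complex.ofReal_mul, ← Complex.ofReal_sub, ← Complex.ofReal_sub,
      Complex.ofReal_inj, hKeq]
    generalize ∑ e ∈ Finset.Ioc 0 K, r e = S
    rw [hxR]
    field_simp
    ring

/-- The van der Corput bound for the error term. -/
theorem exists_norm_sigmaError_le {a η : ℝ} (ha : 0 < a) (ha1 : a < 1) (hη : 0 < η) (hη1 : η ≤ 1) :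
    ∃ C : ℝ, ∀ x : ℝ, 1 ≤ x → ‖sigmaError a x‖ ≤ C * x ^ (1 / 3 + 2 * a / 3 + η) := by
  obtain ⟨C1, hC1, h1⟩ := exists_sigmaError_eq ha ha1
  obtain ⟨C2, hC2, h2⟩ := abs_sum_div_rpow_mul_sawtooth_le ha ha1 hη hη1
  obtain ⟨C3, hC3, h3⟩ := abs_sum_rpow_mul_sawtooth_le ha hη hη1
  refine ⟨C1 + C2 + C3, fun x hx => ?_⟩
  obtain ⟨r, hr, he⟩ := h1 x hx
  have h4 := h2 x hx
  have h5 := h3 x hx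
  rw [he, Complex.norm_real, Real.norm_eq_abs]
  have h6 : C1 * x ^ (a / 2) ≤ C1 * x ^ (1 / 3 + 2 * a / 3 + η) :=
    mul_le_mul_of_nonneg_left (Real.rpow_le_rpow_of_exponent_le hx (by linarith)) hC1
  have h7 : C3 * x ^ (1 / 3 + a / 2 + η) ≤ C3 * x ^ (1 / 3 + 2 * a / 3 + η) :=
    mul_le_mul_of_nonneg_left (Real.rpow_le_rpow_of_exponent_le hx (by linarith)) hC3
  refine (abs_sub _ _).trans ((add_le_add_left (abs_sub _ _) _).trans ?_)
  linarith

/-! ### Comparison of exponents and the theorem -/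

lemma rpow_isLittleO_self_iff {p : ℝ} :
    (fun x : ℝ => x ^ p) =o[atTop] (fun x : ℝ => x) ↔ p < 1 := by
  constructor
  · intro h
    by_contra! hp
    have h1 := (Asymptotics.isLittleO_iff.1 h) (show (0 : ℝ) < 1 / 2 by norm_num)
    obtain ⟨x, hx, hx1⟩ := (h1.and (eventually_ge_atTop 1)).exists
    have hx0 : 0 < x := by linarith
    rw [Real.norm_of_nonneg (by positivity), Real.norm_of_nonneg hx0.le] at hx
    have := Real.rpow_le_rpow_of_exponent_le hx1 hp
    rw [Real.rpow_one] at this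
    linarith
  · intro hp
    have h := tendsto_rpow_neg_atTop (y := 1 - p) (by linarith)
    rw [neg_sub] at h
    refine Asymptotics.isLittleO_of_tendsto' ?_ (h.congr' ?_)
    · filter_upwards [eventually_gt_atTop 0] with x hx h0 using absurd h0 hx.ne'
    · filter_upwards [eventually_gt_atTop 0] with x hx
      rw [Real.rpow_sub hx, Real.rpow_one]

theorem mainTheorem3 :
    (∀ α : ℝ, 0 < α → α < 1 / 2 → ∀ ε : ℝ, 0 < ε →
      (fun x : ℝ => sigmaError α x) =O[Filter.atTop]
        (fun x : ℝ => x ^ ((2 * α ^ 2 + 3 * α + 1) / (2 * α + 3) + ε))) ∧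
    (∀ α : ℝ, 0 < α →
      ((∃ ε : ℝ, 0 < ε ∧
        (fun x : ℝ => x ^ ((2 * α ^ 2 + 3 * α + 1) / (2 * α + 3) + ε))
          =o[Filter.atTop] (fun x : ℝ => x)) ↔
        α < (Real.sqrt 17 - 1) / 4)) := by
  constructor
  · intro α h0 h1 ε hε
    obtain ⟨C, hC⟩ := exists_norm_sigmaError_le h0 (by linarith) (lt_min hε one_pos)
      (min_le_right ε 1)
    -- The numerator factors as `(2α + 1)(α + 1)`, so the claim reduces to `2α + 3 ≤ 3(α + 1)`.
    have hexp : 1 / 3 + 2 * α / 3 ≤ (2 * α ^ 2 + 3 * α + 1) / (2 * α + 3) := by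
      rw [le_div_iff₀ (by linarith)]
      nlinarith
    refine Asymptotics.IsBigO.of_bound |C| ?_
    filter_upwards [eventually_ge_atTop 1] with x hx
    have hx0 : 0 < x := by linarith
    rw [Real.norm_of_nonneg (by positivity)]
    calc ‖sigmaError α x‖ ≤ C * x ^ (1 / 3 + 2 * α / 3 + min ε 1) := hC x hx
      _ ≤ |C| * x ^ (1 / 3 + 2 * α / 3 + min ε 1) := by gcongr; exact le_abs_self C
      _ ≤ _ := mul_le_mul_of_nonneg_left (Real.rpow_le_rpow_of_exponent_le hx
          (by linarith [min_le_left ε 1])) (abs_nonneg C)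
  · intro α h0
    simp only [rpow_isLittleO_self_iff]
    have hs : √17 ^ 2 = 17 := Real.sq_sqrt (by norm_num)
    have hs0 := Real.sqrt_nonneg 17
    -- Clearing the denominator gives `2α² + α - 2 < 0`, that is `(4α + 1)² < 17`.
    have hiff : (2 * α ^ 2 + 3 * α + 1) / (2 * α + 3) < 1 ↔ α < (√17 - 1) / 4 := by
      rw [div_lt_one (by linarith)]
      constructor
      · intro h
        have : 4 * α + 1 < √17 := Real.lt_sqrt_of_sq_lt (by nlinarith)
        linarith
      · intro h
        nlinarith
    rw [← hiff]
    constructor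
    · rintro ⟨ε, hε, h⟩
      linarith
    · intro h
      -- Half of the gap between the exponent and 1.
      exact ⟨(1 - (2 * α ^ 2 + 3 * α + 1) / (2 * α + 3)) / 2, by linarith, by linarith⟩
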